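/- Let $\Bbbk$ be an algebraically closed field of prime characteristic $p$, and let $n$ be a positive integer divisible by $p$. Let $\mathfrak{gl}_n=\mathfrak{gl}_n(\Bbbk)$ with its $p$-th power map $x^{[p]}=x^p$, and for $\chi\in\mathfrak{gl}_n^*$ let $U_\chi(\mathfrak{gl}_n)$ be the quotient of the universal enveloping algebra $U(\mathfrak{gl}_n)$ by the ideal generated by all $x^p-x^{[p]}-\chi(x)^p$, $x\in\mathfrak{gl}_n$ (and similarly for restricted subalgebras). Let $\mathfrak h$ be the diagonal matrices, $\mathfrak n^+$ the strictly upper triangular matrices, $\mathfrak b=\mathfrak h\oplus\mathfrak n^+$, $\varepsilon_i\in\mathfrak h^*$ the $i$-th diagonal entry, and $\Lambda=\bigoplus_{i=1}^n\mathbb F_p\,\varepsilon_i\subset\mathfrak h^*$. The Weyl group $W=\mathfrak S_n$ acts on $\Lambda$ by $w(\varepsilon_i)=\varepsilon_{w(i)}$, and by the dot action $w.\lambda=w(\lambda+\rho)-\rho$, where $\rho=\sum_{j=1}^n(n-j)\varepsilon_j$. Let $\chi\in\mathfrak{gl}_n^*$ be the regular nilpotent $p$-character in standard Levi form, i.e.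 $\chi(E_{i+1,i})=1$ for $1\le i\le n-1$, and $\chi(E_{ij})=0$ for all other matrix units. For $\lambda\in\Lambda$ let $\Bbbk_\lambda$ be the one-dimensional $U_\chi(\mathfrak b)$-module on which $\mathfrak n^+$ acts by $0$ and $\mathfrak h$ by $\lambda$, and let $Z_\chi(\lambda)=U_\chi(\mathfrak{gl}_n)\otimes_{U_\chi(\mathfrak b)}\Bbbk_\lambda$ be the baby Verma module. Let $\Bbbk_1$ be the one-dimensional $U_0(\mathfrak{gl}_n)$-module on which $\mathfrak{sl}_n$ acts by $0$ and $E_{11}$ acts by $1$. Then for every $\lambda\in\Lambda$ the module $Z_\chi(\lambda)$ has a unique simple quotient $L_\chi(\lambda)$, and $$L_\chi(\lambda)\otimes\Bbbk_1\cong L_\chi(\lambda)\ \text{ as } U_\chi(\mathfrak{gl}_n)\text{-modules}\quad\Longleftrightarrow\quad \lambda\in W.0 .$$ -/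

import Mathlib

open scoped TensorProduct

attribute [local instance 100] LieRing.ofAssociativeRing

noncomputable section

/-! ### Reduced enveloping algebras -/

section Reduced

variable {k : Type*} [Field k] {L : Type*} [LieRing L] [LieAlgebra k L]

/-- The relations `x ^ p - x^[p] - χ(x) ^ p = 0` in the universal enveloping algebra of a
restricted Lie algebra `L` with `p`-th power map `pm`. -/
inductive ReducedRel (p : ℕ) (pm : L → L) (χ : Module.Dual k L) :
    UniversalEnvelopingAlgebra k L → UniversalEnvelopingAlgebra k L → Prop
  | pow_sub (x : L) : ReducedRel p pm χ
      (UniversalEnvelopingAlgebra.ι k x ^ p - UniversalEnvelopingAlgebra.ι k (pm x)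
        - algebraMap k (UniversalEnvelopingAlgebra k L) (χ x ^ p)) 0

/-- The `χ`-reduced enveloping algebra `U_χ(L)`: the quotient of `U(L)` by the two-sided ideal
generated by all `x ^ p - x^[p] - χ(x) ^ p`. -/
def ReducedEnveloping (p : ℕ) (pm : L → L) (χ : Module.Dual k L) : Type _ :=
  RingQuot (ReducedRel p pm χ)

namespace ReducedEnveloping

variable (p : ℕ) (pm : L → L) (χ : Module.Dual k L)

instance : Ring (ReducedEnveloping p pm χ) :=
  inferInstanceAs (Ring (RingQuot (ReducedRel p pm χ)))

instance : Algebra k (ReducedEnveloping p pm χ) :=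
  inferInstanceAs (Algebra k (RingQuot (ReducedRel p pm χ)))

/-- The quotient map `U(L) → U_χ(L)`. -/
def mk : UniversalEnvelopingAlgebra k L →ₐ[k] ReducedEnveloping p pm χ :=
  RingQuot.mkAlgHom k (ReducedRel p pm χ)

/-- The canonical map `L → U_χ(L)`. -/
def incl : L →ₗ⁅k⁆ ReducedEnveloping p pm χ :=
  ((mk p pm χ : UniversalEnvelopingAlgebra k L →ₐ[k] ReducedEnveloping p pm χ) :
    UniversalEnvelopingAlgebra k L →ₗ⁅k⁆ ReducedEnveloping p pm χ).comp
      (UniversalEnvelopingAlgebra.ι k)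

theorem incl_pow (x : L) : incl p pm χ x ^ p - incl p pm χ (pm x)
    = algebraMap k (ReducedEnveloping p pm χ) (χ x ^ p) := by
  have h := RingQuot.mkAlgHom_rel k (ReducedRel.pow_sub (p := p) (pm := pm) (χ := χ) x)
  rw [map_sub, map_sub, map_pow, map_zero, sub_eq_zero, AlgHom.commutes] at h
  exact h

variable {p pm χ}
variable {A : Type*} [Ring A] [Algebra k A]

/-- The universal property of `U_χ(L)`. -/
def lift (f : L →ₗ⁅k⁆ A) (hf : ∀ x, f x ^ p - f (pm x) = algebraMap k A (χ x ^ p)) :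
    ReducedEnveloping p pm χ →ₐ[k] A :=
  RingQuot.liftAlgHom k ⟨UniversalEnvelopingAlgebra.lift k f, by
    rintro _ _ ⟨x⟩
    simp only [map_sub, map_pow, UniversalEnvelopingAlgebra.lift_ι_apply, AlgHom.commutes,
      map_zero]
    rw [hf x, map_pow, sub_self]⟩

theorem lift_incl (f : L →ₗ⁅k⁆ A)
    (hf : ∀ x, f x ^ p - f (pm x) = algebraMap k A (χ x ^ p)) (x : L) :
    lift f hf (incl p pm χ x) = f x := by
  have h : lift f hf (incl p pm χ x)
      = UniversalEnvelopingAlgebra.lift k f (UniversalEnvelopingAlgebra.ι k x) := by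
    exact RingQuot.liftAlgHom_mkAlgHom_apply k _ _ _
  rw [h, UniversalEnvelopingAlgebra.lift_ι_apply]

/-- The one-dimensional representation of `U_χ(L)` on `k` in which `x ∈ L` acts by the scalar
`φ x`. -/
def oneDimRep (φ : L →ₗ[k] k) (hlie : ∀ x y : L, φ ⁅x, y⁆ = 0)
    (hpow : ∀ x, φ x ^ p - φ (pm x) = χ x ^ p) :
    ReducedEnveloping p pm χ →ₐ[k] Module.End k k :=
  lift
    { toFun := fun x => algebraMap k (Module.End k k) (φ x)
      map_add' := fun x y => by simp
      map_smul' := fun c x => by simp [Algebra.smul_def]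
      map_lie' := fun {x y} => by
        simp [hlie, LieRing.of_associative_ring_bracket, ← map_mul, mul_comm] }
    (fun x => by
      change algebraMap k _ (φ x) ^ p - algebraMap k _ (φ (pm x)) = _
      rw [← map_pow, ← map_sub, hpow])

theorem oneDimRep_incl (φ : L →ₗ[k] k) (hlie : ∀ x y : L, φ ⁅x, y⁆ = 0)
    (hpow : ∀ x, φ x ^ p - φ (pm x) = χ x ^ p) (x : L) (c : k) :
    oneDimRep (p := p) (pm := pm) (χ := χ) φ hlie hpow (incl p pm χ x) c = φ x * c := by
  unfold oneDimRep
  rw [lift_incl]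
  rfl

end ReducedEnveloping

/-- The tensor product of a `U_χ(L)`-module `M` and a `U_χ'(L)`-module `N`, as a
`U_(χ+χ')(L)`-module: `x ∈ L` acts by `x(m ⊗ n) = xm ⊗ n + m ⊗ xn`. -/
def tensorRep {p : ℕ} [Fact p.Prime] [CharP k p] {pm : L → L} {χ χ' ψ : Module.Dual k L}
    (hψ : ψ = χ + χ') {M N : Type*} [AddCommGroup M] [Module k M] [AddCommGroup N] [Module k N]
    (σ : ReducedEnveloping p pm χ →ₐ[k] Module.End k M)
    (τ : ReducedEnveloping p pm χ' →ₐ[k] Module.End k N) :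
    ReducedEnveloping p pm ψ →ₐ[k] Module.End k (M ⊗[k] N) :=
  ReducedEnveloping.lift
    { toFun := fun x => LinearMap.rTensor N (σ (ReducedEnveloping.incl p pm χ x))
        + LinearMap.lTensor M (τ (ReducedEnveloping.incl p pm χ' x))
      map_add' := fun x y => by
        simp only [map_add, LinearMap.rTensor_add, LinearMap.lTensor_add]
        abel
      map_smul' := fun c x => by
        simp only [map_smul, LinearMap.rTensor_smul, LinearMap.lTensor_smul, smul_add,
          RingHom.id_apply]
      map_lie' := fun {x y} => by
        refine TensorProduct.ext' fun m n => ?_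
        simp only [LieHom.map_lie, LieRing.of_associative_ring_bracket, map_sub, map_mul,
          LinearMap.add_apply, LinearMap.sub_apply, Module.End.mul_apply, LinearMap.rTensor_tmul,
          LinearMap.lTensor_tmul, map_add, TensorProduct.sub_tmul, TensorProduct.tmul_sub]
        abel }
    (fun x => by
      set S := σ (ReducedEnveloping.incl p pm χ x) with hS
      set T := τ (ReducedEnveloping.incl p pm χ' x) with hT
      have hc : Commute (LinearMap.rTensor N S) (LinearMap.lTensor M T) := by
        refine TensorProduct.ext' fun m n => ?_
        simp
      obtain ⟨r, hr⟩ := hc.exists_add_pow_prime_eq (Fact.out : p.Prime)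
      have hp0 : (p : Module.End k (M ⊗[k] N)) = 0 := by
        rw [← map_natCast (algebraMap k (Module.End k (M ⊗[k] N))), CharP.cast_eq_zero, map_zero]
      have h1 : S ^ p - σ (ReducedEnveloping.incl p pm χ (pm x))
          = algebraMap k _ (χ x ^ p) := by
        rw [hS, ← map_pow, ← map_sub, ReducedEnveloping.incl_pow, AlgHom.commutes]
      have h2 : T ^ p - τ (ReducedEnveloping.incl p pm χ' (pm x))
          = algebraMap k _ (χ' x ^ p) := by
        rw [hT, ← map_pow, ← map_sub, ReducedEnveloping.incl_pow, AlgHom.commutes]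
      change (LinearMap.rTensor N S + LinearMap.lTensor M T) ^ p
        - (LinearMap.rTensor N (σ (ReducedEnveloping.incl p pm χ (pm x)))
          + LinearMap.lTensor M (τ (ReducedEnveloping.incl p pm χ' (pm x)))) = _
      rw [hr, hp0, zero_mul, zero_mul, zero_mul, add_zero, LinearMap.rTensor_pow,
        LinearMap.lTensor_pow, sub_eq_iff_eq_add.mp h1, sub_eq_iff_eq_add.mp h2, hψ,
        LinearMap.add_apply, add_pow_char]
      refine TensorProduct.ext' fun m n => ?_
      simp only [LinearMap.add_apply, LinearMap.sub_apply, LinearMap.rTensor_tmul,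
        LinearMap.lTensor_tmul, Module.algebraMap_end_apply, TensorProduct.add_tmul, TensorProduct.tmul_add,
        TensorProduct.smul_tmul', TensorProduct.tmul_smul, map_add]
      abel)

theorem tensorRep_incl {p : ℕ} [Fact p.Prime] [CharP k p] {pm : L → L}
    {χ χ' ψ : Module.Dual k L} (hψ : ψ = χ + χ') {M N : Type*} [AddCommGroup M] [Module k M]
    [AddCommGroup N] [Module k N]
    (σ : ReducedEnveloping p pm χ →ₐ[k] Module.End k M)
    (τ : ReducedEnveloping p pm χ' →ₐ[k] Module.End k N) (x : L) (m : M) (c : N) :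
    tensorRep hψ σ τ (ReducedEnveloping.incl p pm ψ x) (m ⊗ₜ[k] c)
      = σ (ReducedEnveloping.incl p pm χ x) m ⊗ₜ[k] c
        + m ⊗ₜ[k] τ (ReducedEnveloping.incl p pm χ' x) c := by
  unfold tensorRep
  rw [ReducedEnveloping.lift_incl]
  rfl

end Reduced

/-! ### Modules from representations, and induction -/

section Modules

variable {k : Type*} [Field k] {A B : Type*} [Ring A] [Algebra k A] [Ring B] [Algebra k B]
  {M : Type*} [AddCommGroup M] [Module k M]

/-- The space `M` regarded as an `A`-module through the representation `σ`. -/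
def RepModule (_σ : A →ₐ[k] Module.End k M) : Type _ := M

instance (σ : A →ₐ[k] Module.End k M) : AddCommGroup (RepModule σ) :=
  inferInstanceAs (AddCommGroup M)

instance (σ : A →ₐ[k] Module.End k M) : Module k (RepModule σ) :=
  inferInstanceAs (Module k M)

instance (σ : A →ₐ[k] Module.End k M) : Module A (RepModule σ) :=
  Module.compHom M σ.toRingHom

/-- The `A`-submodule of `A ⊗[k] M` generated by the elements `a f(b) ⊗ m - a ⊗ b m`. -/
def inducedRelations (f : B →ₐ[k] A) (σ : B →ₐ[k] Module.End k M) : Submodule A (A ⊗[k] M) :=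
  Submodule.span A {t | ∃ (a : A) (b : B) (m : M), t = (a * f b) ⊗ₜ[k] m - a ⊗ₜ[k] (σ b m)}

/-- The induced module `A ⊗_B M`. -/
abbrev InducedModule (f : B →ₐ[k] A) (σ : B →ₐ[k] Module.End k M) : Type _ :=
  (A ⊗[k] M) ⧸ inducedRelations f σ

/-- The sum of all proper submodules. -/
def sumOfProperSubmodules (A : Type*) [Ring A] (Z : Type*) [AddCommGroup Z] [Module A Z] :
    Submodule A Z :=
  sSup {N : Submodule A Z | N ≠ ⊤}

end Modules

/-! ### The general linear Lie algebra -/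

section GeneralLinear

variable (k : Type*) [Field k] (n : ℕ)

/-- The Lie algebra `𝔤𝔩_n`. -/
abbrev gln : Type _ := Matrix (Fin n) (Fin n) k

/-- The Borel subalgebra of upper triangular matrices. -/
def upperBorel : LieSubalgebra k (gln k n) where
  carrier := {x | ∀ i j : Fin n, j < i → x i j = 0}
  add_mem' := fun {x y} hx hy i j h => by simp [hx i j h, hy i j h]
  zero_mem' := fun i j _ => rfl
  smul_mem' := fun c x hx i j h => by simp [hx i j h]
  lie_mem' := fun {x y} hx hy => by
    have hx' : Matrix.BlockTriangular x id := fun i j h => hx i j h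
    have hy' : Matrix.BlockTriangular y id := fun i j h => hy i j h
    intro i j h
    exact ((hx'.mul hy').sub (hy'.mul hx')) h

variable {k n}

theorem upperBorel_pow_mem (p : ℕ) {x : gln k n} (hx : x ∈ upperBorel k n) : x ^ p ∈ upperBorel k n := by
  have hx' : Matrix.BlockTriangular x id := fun i j h => hx i j h
  exact fun i j h => hx'.pow p h

theorem upperBorel_mul_diag {x y : gln k n} (hx : x ∈ upperBorel k n) (hy : y ∈ upperBorel k n) (i : Fin n) :
    (x * y) i i = x i i * y i i := by
  rw [Matrix.mul_apply, Finset.sum_eq_single i]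
  · intro j _ hj
    rcases lt_or_gt_of_ne hj with h | h
    · rw [hx i j h, zero_mul]
    · rw [hy j i h, mul_zero]
  · simp

theorem upperBorel_pow_diag (p : ℕ) {x : gln k n} (hx : x ∈ upperBorel k n) (i : Fin n) :
    (x ^ p) i i = x i i ^ p := by
  induction p with
  | zero => simp
  | succ q ih => rw [pow_succ, upperBorel_mul_diag (upperBorel_pow_mem q hx) hx, ih, pow_succ]

/-- The `p`-th power map of `𝔤𝔩_n`. -/
def glPow (p : ℕ) (x : gln k n) : gln k n := x ^ p

/-- The `p`-th power map of the Borel subalgebra. -/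
def upperBorelPow (p : ℕ) (x : upperBorel k n) : upperBorel k n :=
  ⟨(x : gln k n) ^ p, upperBorel_pow_mem p x.2⟩

variable (p : ℕ)

/-- The reduced enveloping algebra `U_χ(𝔤𝔩_n)`. -/
abbrev GLReduced (χ : Module.Dual k (gln k n)) : Type _ :=
  ReducedEnveloping p (glPow (k := k) (n := n) p) χ

/-- The restriction of a linear form on `𝔤𝔩_n` to the Borel subalgebra. -/
def restrictBorel (χ : Module.Dual k (gln k n)) : Module.Dual k (upperBorel k n) :=
  χ.comp (upperBorel k n).toSubmodule.subtype

/-- The reduced enveloping algebra `U_χ(𝔟)`. -/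
abbrev BorelReduced (χ : Module.Dual k (gln k n)) : Type _ :=
  ReducedEnveloping p (upperBorelPow (k := k) (n := n) p) (restrictBorel χ)

/-- The algebra map `U_χ(𝔟) → U_χ(𝔤𝔩_n)` extending the inclusion. -/
def borelToGL (χ : Module.Dual k (gln k n)) : BorelReduced p χ →ₐ[k] GLReduced p χ :=
  ReducedEnveloping.lift
    ((ReducedEnveloping.incl p (glPow p) χ).comp (upperBorel k n).incl)
    (fun x => ReducedEnveloping.incl_pow p (glPow p) χ (x : gln k n))

theorem borelToGL_incl (χ : Module.Dual k (gln k n)) (x : upperBorel k n) :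
    borelToGL p χ (ReducedEnveloping.incl p (upperBorelPow p) (restrictBorel χ) x)
      = ReducedEnveloping.incl p (glPow p) χ (x : gln k n) :=
  ReducedEnveloping.lift_incl _ _ x

variable [Fact p.Prime] [CharP k p]

/-- The linear form on `𝔟` given by the weight `∑ i, l i • ε i`, `l i ∈ 𝔽_p`: it vanishes on
`𝔫⁺` and sends a diagonal matrix `h` to `∑ i, l i * h i i`. -/
def borelWeight (l : Fin n → ZMod p) : upperBorel k n →ₗ[k] k where
  toFun x := ∑ i, ZMod.castHom (dvd_refl p) k (l i) * (x : gln k n) i i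
  map_add' x y := by simp [mul_add, Finset.sum_add_distrib]
  map_smul' c x := by simp [Finset.mul_sum, mul_left_comm]

/-- The one-dimensional `U_χ(𝔟)`-module `k_l` of weight `l`, for `χ` vanishing on `𝔟`. -/
def borelWeightRep (χ : Module.Dual k (gln k n)) (hχ : ∀ x ∈ upperBorel k n, χ x = 0)
    (l : Fin n → ZMod p) : BorelReduced p χ →ₐ[k] Module.End k k :=
  ReducedEnveloping.oneDimRep (borelWeight p l)
    (fun x y => by
      have h : ∀ i, ((⁅x, y⁆ : upperBorel k n) : gln k n) i i = 0 := fun i => by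
        rw [LieSubalgebra.coe_bracket, LieRing.of_associative_ring_bracket, Matrix.sub_apply,
          upperBorel_mul_diag x.2 y.2, upperBorel_mul_diag y.2 x.2, mul_comm, sub_self]
      simp [borelWeight, h])
    (fun x => by
      have hx : restrictBorel χ x = 0 := hχ x x.2
      have hp : p ≠ 0 := (Fact.out : p.Prime).ne_zero
      rw [hx, zero_pow hp, sub_eq_zero]
      change (∑ i, ZMod.castHom (dvd_refl p) k (l i) * (x : gln k n) i i) ^ p
        = ∑ i, ZMod.castHom (dvd_refl p) k (l i) * ((x : gln k n) ^ p) i i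
      rw [sum_pow_char]
      refine Finset.sum_congr rfl fun i _ => ?_
      rw [upperBorel_pow_diag p x.2, mul_pow, ← map_pow, ZMod.pow_card])

theorem borelWeightRep_incl (χ : Module.Dual k (gln k n)) (hχ : ∀ x ∈ upperBorel k n, χ x = 0)
    (l : Fin n → ZMod p) (x : upperBorel k n) (c : k) :
    borelWeightRep p χ hχ l (ReducedEnveloping.incl p (upperBorelPow p) (restrictBorel χ) x) c
      = borelWeight p l x * c :=
  ReducedEnveloping.oneDimRep_incl _ _ _ x c

/-- The baby Verma module `Z_χ(l) = U_χ(𝔤𝔩_n) ⊗_{U_χ(𝔟)} k_l`. -/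
abbrev BabyVerma (χ : Module.Dual k (gln k n)) (hχ : ∀ x ∈ upperBorel k n, χ x = 0)
    (l : Fin n → ZMod p) : Type _ :=
  InducedModule (borelToGL p χ) (borelWeightRep p χ hχ l)

/-- `L_χ(l)`: the quotient of `Z_χ(l)` by the sum of all its proper submodules. When `Z_χ(l)` has
a unique simple quotient, `L_χ(l)` is that quotient. -/
abbrev SimpleHead (χ : Module.Dual k (gln k n)) (hχ : ∀ x ∈ upperBorel k n, χ x = 0)
    (l : Fin n → ZMod p) : Type _ :=
  BabyVerma p χ hχ l ⧸ sumOfProperSubmodules (GLReduced p χ) (BabyVerma p χ hχ l)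

theorem trace_pow_char (x : gln k n) : (x ^ p).trace = x.trace ^ p := by
  rcases isEmpty_or_nonempty (Fin n) with he | he
  · simp [Matrix.trace, (Fact.out : p.Prime).ne_zero]
  have hpos : 0 < p := (Fact.out : p.Prime).pos
  have h : Polynomial.expand k p (x ^ p).charpoly = x.charpoly ^ p := by
    unfold Matrix.charpoly
    rw [AlgHom.map_det, ← Matrix.coe_detMonoidHom,
      ← (Matrix.detMonoidHom : Matrix (Fin n) (Fin n) (Polynomial k) →* Polynomial k).map_pow]
    apply congr_arg Matrix.det
    refine matPolyEquiv.injective ?_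
    rw [map_pow, Matrix.matPolyEquiv_charmatrix, sub_pow_char_of_commute, ← Polynomial.C_pow]
    · exact (id (matPolyEquiv_eq_X_pow_sub_C p x) :)
    · exact (Polynomial.C x).commute_X
  have h' : (x ^ p).charpoly = x.charpoly.map (frobenius k p) := by
    apply Polynomial.expand_injective hpos
    rw [h, ← Polynomial.map_expand, Polynomial.map_frobenius_expand]
  rw [Matrix.trace_eq_neg_charpoly_nextCoeff, Matrix.trace_eq_neg_charpoly_nextCoeff, h',
    Polynomial.nextCoeff_map (frobenius k p).injective, frobenius_def]
  rw [← frobenius_def, ← frobenius_def, map_neg]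

/-- The one-dimensional `U_0(𝔤𝔩_n)`-module `k_a`, `a ∈ 𝔽_p`: `x` acts by the scalar
`a * trace x`, so that `𝔰𝔩_n` acts by `0` and `E_{11}` by `a`. -/
def traceRep (a : ZMod p) : GLReduced p (0 : Module.Dual k (gln k n)) →ₐ[k] Module.End k k :=
  ReducedEnveloping.oneDimRep
    (ZMod.castHom (dvd_refl p) k a • Matrix.traceLinearMap (Fin n) k k)
    (fun x y => by
      simp [LieRing.of_associative_ring_bracket, Matrix.trace_mul_comm x y])
    (fun x => by
      have hp : p ≠ 0 := (Fact.out : p.Prime).ne_zero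
      simp only [LinearMap.smul_apply, Matrix.traceLinearMap_apply, glPow, smul_eq_mul,
        LinearMap.zero_apply, zero_pow hp]
      rw [trace_pow_char, mul_pow, ← map_pow, ZMod.pow_card, sub_self])

theorem traceRep_incl (a : ZMod p) (x : gln k n) (c : k) :
    traceRep p a (ReducedEnveloping.incl p (glPow p) 0 x) c
      = ZMod.castHom (dvd_refl p) k a * x.trace * c :=
  ReducedEnveloping.oneDimRep_incl _ _ _ x c

/-- The `U_χ(𝔤𝔩_n)`-module `M ⊗ k_a`, for a `U_χ(𝔤𝔩_n)`-module `M`. -/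
abbrev TwistByTrace (χ : Module.Dual k (gln k n)) (M : Type*) [AddCommGroup M] [Module k M]
    [Module (GLReduced p χ) M] [IsScalarTower k (GLReduced p χ) M] (a : ZMod p) : Type _ :=
  RepModule (tensorRep (add_zero χ).symm (Algebra.lsmul k k M) (traceRep (k := k) (n := n) p a))

end GeneralLinear

section RegularNilpotent

variable (k : Type*) [Field k] (n : ℕ)

/-- The regular nilpotent `p`-character `χ` in standard Levi form: `χ(E_{i+1,i}) = 1`, while `χ`
vanishes on all the other matrix units. -/
def regularNilpotent : Module.Dual k (gln k n) where
  toFun x := ∑ i : Fin n, ∑ j : Fin n, if (i : ℕ) = (j : ℕ) + 1 then x i j else 0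
  map_add' x y := by
    simp only [← Finset.sum_add_distrib]
    refine Finset.sum_congr rfl fun i _ => Finset.sum_congr rfl fun j _ => ?_
    split_ifs <;> simp
  map_smul' c x := by
    simp only [Finset.mul_sum, RingHom.id_apply, smul_eq_mul]
    refine Finset.sum_congr rfl fun i _ => Finset.sum_congr rfl fun j _ => ?_
    split_ifs <;> simp

theorem regularNilpotent_borel : ∀ x ∈ upperBorel k n, regularNilpotent k n x = 0 := by
  intro x hx
  change (∑ i : Fin n, ∑ j : Fin n, if (i : ℕ) = (j : ℕ) + 1 then x i j else 0) = 0
  refine Finset.sum_eq_zero fun i _ => Finset.sum_eq_zero fun j _ => ?_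
  split_ifs with h
  · exact hx i j (by rw [Fin.lt_def]; omega)
  · rfl

end RegularNilpotent

/-! ### The dot action of the Weyl group on the weights -/

section DotAction

variable {n p : ℕ}

/-- `ρ = ∑_{j=1}^{n} (n - j) ε_j`, reduced modulo `p` (`j = i + 1` with `i : Fin n`). -/
def weylRho : Fin n → ZMod p := fun i => (n : ZMod p) - ((i : ℕ) + 1 : ZMod p)

/-- The dot action `w.l = w(l + ρ) - ρ` of the symmetric group, where `w(ε_i) = ε_{w(i)}`. -/
def dotAction (w : Equiv.Perm (Fin n)) (l : Fin n → ZMod p) : Fin n → ZMod p :=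
  fun i => (l (w⁻¹ i) + weylRho (w⁻¹ i)) - weylRho i

end DotAction

end

/-! ### Jacobson's formula -/

section Jacobson

/-! Write x = λ + ρ, and call a vector singular if 𝔫⁺ kills it and it has a weight.

Simple head. The form χ vanishes on [𝔫⁻, 𝔫⁻], so y ↦ y − χ(y) is an action of 𝔫⁻ on every
U_χ-module, and each operator in it is nilpotent. If a singular vector v generates M, then M = kv +
J, where J is spanned by the images of these operators. If v ∈ J then J = M, and Engel's theorem
forces M = 0. Applied to quotients, this shows that every proper submodule lies in J; as v ∉ J when
M ≠ 0, the sum of the proper submodules is proper (`sumOfProperSubmodules_ne_top`). That Z_χ(λ) ≠ 0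
needs no PBW theorem: Weyl algebras and tensor products give a nonzero module (`hasModule`), it has
a singular vector of some weight, and tensoring with the natural module reaches all the other
weights (`occursSingular`).

Reflections. Since E_{i+1,i}^p acts as 1, the vector E_{i+1,i}^r v with r ≡ x_i − x_{i+1} is
nonzero; it is singular, and x_i and x_{i+1} are exchanged in its weight. So all permutations of x
occur in L_χ(λ) (`HasSingular.comp_perm`), and a simple module with a singular vector of weight μ is
L_χ(μ). As p ∣ n, ρ − (1,…,1) is a permutation of ρ. For λ ∈ W.0 it follows that x − (1,…,1) occurs
in L_χ(λ), hence x occurs in L_χ(λ) ⊗ k_1, which is the implication from right to left.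

Conversely, an isomorphism gives singular vectors of weights λ and λ + (1,…,1) in one cyclic module,
so the invariants tr(E^m) take equal values on them. The generating function of these values amounts
to ∏(T − x_i − 1)/∏(T − x_i). Its invariance under x ↦ x + (1,…,1) says that the multiplicities of
the residues in x have zero second difference on ℤ/p. They are therefore constant, and x is a
permutation of ρ. -/

theorem choose_prime_sub_one_cast {A : Type*} [Ring A] {p : ℕ} (hp : p.Prime)
    (hA : (p : A) = 0) : ∀ i < p, ((p - 1).choose i : A) = (-1) ^ i := by
  intro i
  induction i with
  | zero => intro _; simp
  | succ i ih =>
    intro hi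
    have h1 : p.choose (i + 1) = (p - 1).choose i + (p - 1).choose (i + 1) := by
      conv_lhs => rw [← Nat.sub_add_cancel hp.one_le]
      exact Nat.choose_succ_succ _ _
    obtain ⟨c, hc⟩ := hp.dvd_choose_self (Nat.succ_ne_zero i) hi
    have h2 : ((p - 1).choose i : A) + ((p - 1).choose (i + 1) : A) = 0 := by
      rw [← Nat.cast_add, ← h1, hc, Nat.cast_mul, hA, zero_mul]
    rw [ih (by omega)] at h2
    rw [pow_succ, mul_neg_one]
    exact (neg_eq_of_add_eq_zero_right h2).symm

/-- The binomial coefficients of p − 1 are signs modulo p. Used for left and right multiplication by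
one element, this turns the derivative of a p-th power into an iterated commutator. -/
theorem Commute.sub_pow_prime_sub_one {A : Type*} [Ring A] {p : ℕ} (hp : p.Prime)
    (hA : (p : A) = 0) {a b : A} (h : Commute a b) :
    (a - b) ^ (p - 1) = ∑ i ∈ Finset.range p, a ^ i * b ^ (p - 1 - i) := by
  have h' : Commute (-b) a := h.symm.neg_left
  rw [sub_eq_neg_add, h'.add_pow, Nat.sub_add_cancel hp.one_le, ← Finset.sum_range_reflect]
  refine Finset.sum_congr rfl fun i hi => ?_
  have hi' : i < p := Finset.mem_range.mp hi
  have e : p - 1 - (p - 1 - i) = i := by omega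
  have h1 : Commute (b ^ (p - 1 - i)) (a ^ i) := h.symm.pow_pow _ _
  have h2 : ∀ z : A, Commute ((-1) ^ (p - 1 - i)) z := fun z =>
    (Commute.neg_one_left z).pow_left _
  rw [e, choose_prime_sub_one_cast hp hA _ (by omega), neg_pow b, ← (h2 _).eq, ← mul_assoc,
    ← mul_assoc, ← mul_pow, neg_one_mul, neg_neg, one_pow, one_mul, h1.eq]
  exact Commute.refl _

/-- The coefficient of `T ^ m` in `(ad (T x + y)) ^ j x`. -/
def adCoeff {L : Type*} [LieRing L] (x y : L) : ℕ → ℕ → L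
  | 0, 0 => x
  | 0, _ + 1 => 0
  | j + 1, 0 => ⁅y, adCoeff x y j 0⁆
  | j + 1, m + 1 => ⁅x, adCoeff x y j m⁆ + ⁅y, adCoeff x y j (m + 1)⁆

theorem LieHom.map_adCoeff {R L L' : Type*} [CommRing R] [LieRing L] [LieAlgebra R L] [LieRing L']
    [LieAlgebra R L'] (f : L →ₗ⁅R⁆ L') (x y : L) (j m : ℕ) :
    f (adCoeff x y j m) = adCoeff (f x) (f y) j m := by
  induction j generalizing m with
  | zero => cases m <;> simp [adCoeff]
  | succ j ih => cases m <;> simp [adCoeff, ih]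

open Polynomial in
-- Leibniz rule without commutativity: each differentiated factor stays in its place.
theorem derivative_linear_pow {A : Type*} [Ring A] (x y : A) (m : ℕ) :
    derivative ((C x * X + C y) ^ m)
      = ∑ i ∈ Finset.range m, (C x * X + C y) ^ i * (C x * (C x * X + C y) ^ (m - 1 - i)) := by
  induction m with
  | zero => simp
  | succ m ih =>
    rw [pow_succ', derivative_mul, ih, Finset.sum_range_succ']
    have : derivative (C x * X + C y) = C x := by simp
    rw [this, Finset.mul_sum, add_comm]
    congr 1
    · refine Finset.sum_congr rfl fun i hi => ?_
      have e : m + 1 - 1 - (i + 1) = m - 1 - i := by omega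
      rw [e, pow_succ', mul_assoc]
    · simp

open Polynomial in
theorem coeff_ad_linear_pow {A : Type*} [Ring A] (x y : A) (j m : ℕ) :
    (((LinearMap.mulLeft ℤ (C x * X + C y) - LinearMap.mulRight ℤ (C x * X + C y) :
      Module.End ℤ A[X]) ^ j) (C x)).coeff m = adCoeff x y j m := by
  induction j generalizing m with
  | zero => cases m <;> simp [adCoeff, coeff_C]
  | succ j ih =>
    rw [pow_succ', Module.End.mul_apply]
    set q := ((LinearMap.mulLeft ℤ (C x * X + C y) - LinearMap.mulRight ℤ (C x * X + C y) :
      Module.End ℤ A[X]) ^ j) (C x)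
    rw [LinearMap.sub_apply, LinearMap.mulLeft_apply, LinearMap.mulRight_apply, coeff_sub, add_mul,
      mul_add, mul_assoc (C x), X_mul, ← mul_assoc (C x), ← mul_assoc q, coeff_add, coeff_add]
    cases m with
    | zero => simp [adCoeff, ← ih, LieRing.of_associative_ring_bracket]
    | succ m =>
      simp only [coeff_mul_X, coeff_C_mul, coeff_mul_C, adCoeff, ← ih,
        LieRing.of_associative_ring_bracket]
      abel

open Polynomial in
/-- Jacobson's formula for the `p`-th power of a sum. -/
theorem add_pow_prime_eq_add_adCoeff {k A : Type*} [Field k] [Ring A] [Algebra k A] (p : ℕ)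
    [Fact p.Prime] [CharP k p] (x y : A) :
    (x + y) ^ p = x ^ p + y ^ p
      + ∑ i ∈ Finset.range (p - 1), ((i + 1 : ℕ) : k)⁻¹ • adCoeff x y (p - 1) i := by
  have hp : p.Prime := Fact.out
  have hA : (p : A) = 0 := by
    rw [← map_natCast (algebraMap k A), CharP.cast_eq_zero, map_zero]
  set Q : A[X] := C x * X + C y with hQ
  have hdeg : Q.natDegree ≤ 1 := natDegree_linear_le
  -- The sum from the Leibniz rule is (L − R)^(p−1) applied to x, with L and R the multiplications
  -- by Q.
  have hder : derivative (Q ^ p)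
      = ((LinearMap.mulLeft ℤ Q - LinearMap.mulRight ℤ Q : Module.End ℤ A[X]) ^ (p - 1))
        (C x) := by
    have h0 : (p : Module.End ℤ A[X]) = 0 := by
      ext q : 1
      simp only [Module.End.natCast_apply, LinearMap.zero_apply, nsmul_eq_mul]
      rw [← C_eq_natCast, hA, C_0, zero_mul]
    rw [(LinearMap.commute_mulLeft_right Q Q).sub_pow_prime_sub_one hp h0, hQ,
      derivative_linear_pow, LinearMap.sum_apply]
    refine Finset.sum_congr rfl fun i _ => ?_
    rw [Module.End.mul_apply, LinearMap.pow_mulLeft, LinearMap.pow_mulRight,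
      LinearMap.mulLeft_apply, LinearMap.mulRight_apply]
  -- The coefficient of degree i + 1 is recovered from the derivative by dividing by i + 1,
  -- invertible since i + 1 < p. The degrees 0 and p give y^p and x^p.
  have hcoeff : ∀ i ∈ Finset.range (p - 1),
      (Q ^ p).coeff (i + 1) = ((i + 1 : ℕ) : k)⁻¹ • adCoeff x y (p - 1) i := by
    intro i hi
    have hne : ((i + 1 : ℕ) : k) ≠ 0 := by
      rw [Ne, CharP.cast_eq_zero_iff k p]
      exact Nat.not_dvd_of_pos_of_lt (Nat.succ_pos i) (by have := Finset.mem_range.mp hi; omega)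
    rw [← coeff_ad_linear_pow, ← hQ, ← hder, coeff_derivative, eq_inv_smul_iff₀ hne,
      Algebra.smul_def, map_natCast, ← Nat.cast_succ, Nat.cast_comm]
  -- Evaluation at 1 is multiplicative over a noncommutative ring because 1 is central.
  have heval : eval 1 (Q ^ p) = (x + y) ^ p := by
    have := map_pow (eval₂RingHom' (RingHom.id A) 1 fun a => Commute.one_right a) Q p
    have hQ1 : eval₂RingHom' (RingHom.id A) 1 (fun a => Commute.one_right a) Q = x + y := by
      simp [hQ]
    rw [hQ1] at this
    exact this
  rw [← heval, eval_eq_sum_range' (n := p + 1)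
    (by have := natDegree_pow_le_of_le p hdeg; omega)]
  simp only [one_pow, mul_one]
  rw [Finset.sum_range_succ]
  obtain ⟨q, hq⟩ : ∃ q, p = q + 1 := ⟨p - 1, by have := hp.one_le; omega⟩
  have h1 : (Q ^ p).coeff p = x ^ p := by
    have := coeff_pow_of_natDegree_le (m := p) hdeg
    rw [mul_one] at this
    rw [this]
    simp [hQ]
  have h2 : (Q ^ p).coeff 0 = y ^ p := by
    have := map_pow (constantCoeff (R := A)) Q p
    simpa [hQ] using this
  rw [h1, ← Finset.sum_congr rfl hcoeff]
  have : ∑ i ∈ Finset.range p, (Q ^ p).coeff i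
      = ∑ i ∈ Finset.range (p - 1), (Q ^ p).coeff (i + 1) + (Q ^ p).coeff 0 := by
    conv_lhs => rw [hq]
    rw [Finset.sum_range_succ', show q = p - 1 by omega, Nat.sub_add_cancel hp.one_le]
  rw [this, h2]
  abel

variable {k A B : Type*} [Field k] [Ring A] [Algebra k A] [Ring B] [Algebra k B] (p : ℕ)
    [Fact p.Prime] [CharP k p]

/-- The failure of a Lie homomorphism of associative algebras to preserve `p`-th powers is
additive. -/
theorem LieHom.map_add_pow_sub (f : B →ₗ⁅k⁆ A) (x y : B) :
    f (x + y) ^ p - f ((x + y) ^ p) = (f x ^ p - f (x ^ p)) + (f y ^ p - f (y ^ p)) := by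
  rw [add_pow_prime_eq_add_adCoeff (k := k) p x y, map_add,
    add_pow_prime_eq_add_adCoeff (k := k) p (f x) (f y)]
  simp only [map_add, map_sum, map_smul, LieHom.map_adCoeff]
  abel

end Jacobson

/-! ### Weyl algebras -/

section Weyl

variable {A : Type*} [Ring A]

theorem mul_pow_of_commutator_eq_one {X D : A} (h : D * X = X * D + 1) (m : ℕ) :
    X * D * X ^ m = X ^ m * (X * D + m) := by
  induction m with
  | zero => simp
  | succ m ih =>
    rw [pow_succ, ← mul_assoc, ih, mul_assoc, mul_assoc]
    congr 1
    have : (X * D + m) * X = X * (D * X) + m * X := by noncomm_ring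
    rw [this, h, Nat.cast_comm]
    push_cast
    noncomm_ring

/-- Moving XD past X^m shifts it by m, so X^m D^m is a falling factorial in XD. -/
theorem pow_mul_pow_succ_of_commutator_eq_one {X D : A} (h : D * X = X * D + 1) (m : ℕ) :
    X ^ (m + 1) * D ^ (m + 1) = (X * D - m) * (X ^ m * D ^ m) := by
  have h1 := mul_pow_of_commutator_eq_one h m
  rw [mul_add] at h1
  have h2 : (X * D - (m : A)) * X ^ m = X ^ m * (X * D) := by
    rw [sub_mul, h1, Nat.cast_comm]
    abel
  rw [← mul_assoc, h2, pow_succ, pow_succ']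
  noncomm_ring

open Polynomial in
theorem prod_range_prime_X_sub_natCast (k : Type*) [Field k] (p : ℕ) [Fact p.Prime] [CharP k p] :
    ∏ i ∈ Finset.range p, (X - C (i : k)) = (X ^ p - X : k[X]) := by
  have h : (X ^ p - X : (ZMod p)[X]) = ∏ c : ZMod p, (X - C c) := by
    have hs := FiniteField.splits_X_pow_card_sub_X (K := ZMod p) p
    have hm : (X ^ p - X : (ZMod p)[X]).Monic :=
      monic_X_pow_sub (by
        rw [degree_X]; exact_mod_cast (Fact.out : p.Prime).one_lt)
    have hr : (X ^ p - X : (ZMod p)[X]).roots = Finset.univ.val := by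
      have := FiniteField.roots_X_pow_card_sub_X (ZMod p)
      rwa [ZMod.card] at this
    have := hs.eq_prod_roots_of_monic (by simpa using hm)
    simp only [Polynomial.map_sub, Polynomial.map_pow, map_X, ZMod.card] at this
    rw [this, hr]
    rfl
  have h2 := congrArg (Polynomial.map (ZMod.castHom (dvd_refl p) k)) h
  rw [Polynomial.map_prod] at h2
  simp only [Polynomial.map_sub, Polynomial.map_pow, map_X, map_C] at h2
  rw [h2]
  refine Finset.prod_bij (fun i _ => (i : ZMod p)) (fun _ _ => Finset.mem_univ _) ?_ ?_ ?_
  · intro i hi j hj hij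
    have := congrArg ZMod.val hij
    rwa [ZMod.val_cast_of_lt (Finset.mem_range.mp hi),
      ZMod.val_cast_of_lt (Finset.mem_range.mp hj)] at this
  · exact fun c _ => ⟨c.val, Finset.mem_range.mpr (ZMod.val_lt c), ZMod.natCast_zmod_val c⟩
  · intro i _
    simp

open Polynomial in
-- The falling factorial of length p is T^p − T, evaluated here at T = XD. This is the p-power
-- relation for a diagonal matrix unit in `weylRep`.
theorem mul_pow_prime_of_commutator_eq_one {k A : Type*} [Field k] [Ring A] [Algebra k A] (p : ℕ)
    [Fact p.Prime] [CharP k p] {X D : A} (h : D * X = X * D + 1) :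
    (X * D) ^ p - X * D = X ^ p * D ^ p := by
  have key : ∀ m, X ^ m * D ^ m
      = aeval (X * D) (∏ i ∈ Finset.range m, (Polynomial.X - C (i : k))) := by
    intro m
    induction m with
    | zero => simp
    | succ m ih =>
      rw [pow_mul_pow_succ_of_commutator_eq_one h, ih, Finset.prod_range_succ, mul_comm, map_mul]
      simp
  rw [key, prod_range_prime_X_sub_natCast]
  simp

end Weyl

/-! ### Existence of modules with a given `p`-character -/

section WeylRep

variable {k : Type*} [Field k] {n : ℕ} {A : Type*} [Ring A] [Algebra k A]

/-- The linear map `E_{ij} ↦ X_i D_j`. -/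
def weylLinear (X D : Fin n → A) : gln k n →ₗ[k] A where
  toFun x := ∑ i, ∑ j, x i j • (X i * D j)
  map_add' x y := by simp [add_smul, Finset.sum_add_distrib]
  map_smul' c x := by simp [Finset.smul_sum, mul_smul]

theorem weylLinear_single (X D : Fin n → A) (i j : Fin n) :
    weylLinear X D (Matrix.single i j (1 : k)) = X i * D j := by
  change ∑ a, ∑ b, (Matrix.single i j (1 : k)) a b • (X a * D b) = _
  rw [Finset.sum_eq_single i, Finset.sum_eq_single j]
  · simp
  · intro b _ hb
    simp [hb.symm]
  · simp
  · intro a _ ha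
    refine Finset.sum_eq_zero fun b _ => ?_
    simp [ha.symm]
  · simp

variable {X D : Fin n → A} (hXX : ∀ i j, Commute (X i) (X j)) (hDD : ∀ i j, Commute (D i) (D j))
  (hDX : ∀ i j, D j * X i = X i * D j + if i = j then 1 else 0)

include hDX in
-- The normally ordered quadratic term is symmetric in x and y once the X's and the D's commute
-- among themselves, so it cancels in commutators.
theorem weylLinear_mul (x y : gln k n) : weylLinear X D x * weylLinear X D y
    = weylLinear X D (x * y)
      + ∑ i, ∑ j, ∑ a, ∑ b, (x i j * y a b) • (X i * X a * (D j * D b)) := by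
  have h1 : weylLinear X D (x * y)
      = ∑ i, ∑ j, ∑ a, ∑ b, (x i j * y a b) • (if a = j then X i * D b else 0) := by
    change ∑ i, ∑ b, (x * y) i b • (X i * D b) = _
    refine Finset.sum_congr rfl fun i _ => ?_
    have h2 : ∀ j, ∑ a, ∑ b, (x i j * y a b) • (if a = j then X i * D b else 0)
        = ∑ b, (x i j * y j b) • (X i * D b) := by
      intro j
      rw [Finset.sum_eq_single j]
      · simp
      · intro a _ ha
        simp [ha]
      · simp
    simp only [h2]
    rw [Finset.sum_comm]
    refine Finset.sum_congr rfl fun b _ => ?_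
    rw [Matrix.mul_apply, Finset.sum_smul]
  rw [h1]
  change (∑ i, ∑ j, x i j • (X i * D j)) * (∑ i, ∑ j, y i j • (X i * D j)) = _
  simp only [← Finset.sum_add_distrib, ← smul_add]
  simp only [Finset.sum_mul]
  simp only [Finset.mul_sum]
  refine Finset.sum_congr rfl fun i _ => Finset.sum_congr rfl fun j _ =>
    Finset.sum_congr rfl fun a _ => Finset.sum_congr rfl fun b _ => ?_
  rw [smul_mul_smul_comm]
  congr 1
  have : X i * D j * (X a * D b) = X i * (D j * X a) * D b := by noncomm_ring
  rw [this, hDX]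
  split_ifs <;> noncomm_ring

include hXX hDD hDX in
theorem weylLinear_lie (x y : gln k n) :
    weylLinear X D ⁅x, y⁆ = ⁅weylLinear X D x, weylLinear X D y⁆ := by
  rw [LieRing.of_associative_ring_bracket, LieRing.of_associative_ring_bracket, map_sub,
    weylLinear_mul hDX, weylLinear_mul hDX]
  have : ∑ i, ∑ j, ∑ a, ∑ b, (x i j * y a b) • (X i * X a * (D j * D b))
      = ∑ i, ∑ j, ∑ a, ∑ b, (y i j * x a b) • (X i * X a * (D j * D b)) := by
    simp_rw [← Fintype.sum_prod_type']
    refine Fintype.sum_equiv (⟨fun q => (q.2.2.1, q.2.2.2, q.1, q.2.1),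
      fun q => (q.2.2.1, q.2.2.2, q.1, q.2.1), fun _ => rfl, fun _ => rfl⟩ :
      (Fin n × Fin n × Fin n × Fin n) ≃ (Fin n × Fin n × Fin n × Fin n)) _ _ fun q => ?_
    simp only [Equiv.coe_fn_mk]
    rw [(hXX _ _).eq, (hDD _ _).eq, mul_comm]
  rw [this]
  abel

variable (p : ℕ) [Fact p.Prime] [CharP k p]

/-- By Jacobson's formula both sides are additive in x, and both scale by c^p; matrix units suffice.
-/
theorem pow_sub_eq_of_single (f : gln k n →ₗ⁅k⁆ A) (χ : Module.Dual k (gln k n))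
    (h : ∀ i j, f (Matrix.single i j 1) ^ p - f (Matrix.single i j 1 ^ p)
      = algebraMap k A (χ (Matrix.single i j 1) ^ p)) (x : gln k n) :
    f x ^ p - f (glPow p x) = algebraMap k A (χ x ^ p) := by
  have hp : p ≠ 0 := (Fact.out : p.Prime).ne_zero
  unfold glPow
  induction x using Matrix.induction_on' with
  | h_zero => simp [hp]
  | h_add x y hx hy => rw [LieHom.map_add_pow_sub, hx, hy, ← map_add, map_add χ, add_pow_char]
  | h_std_basis i j c =>
    have : (Matrix.single i j c : gln k n) = c • Matrix.single i j 1 := by simp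
    rw [this, map_smul, smul_pow, smul_pow, map_smul, ← smul_sub, h, map_smul, smul_eq_mul,
      mul_pow, map_mul, Algebra.smul_def]

theorem single_one_pow {i j : Fin n} (hij : i ≠ j) {m : ℕ} (hm : 2 ≤ m) :
    (Matrix.single i j (1 : k)) ^ m = 0 := by
  have : (Matrix.single i j (1 : k)) ^ 2 = 0 := by
    rw [pow_two, Matrix.single_mul_single_of_ne _ _ _ _ hij.symm]
  exact pow_eq_zero_of_le hm this

theorem single_one_self_pow (i : Fin n) {m : ℕ} (hm : m ≠ 0) :
    (Matrix.single i i (1 : k)) ^ m = Matrix.single i i 1 := by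
  obtain ⟨q, rfl⟩ := Nat.exists_eq_succ_of_ne_zero hm
  induction q with
  | zero => simp
  | succ q ih => rw [pow_succ, ih (Nat.succ_ne_zero q), Matrix.single_mul_single_same, one_mul]

/-- The representation of `U_χ(𝔤𝔩_n)` by elements `X_i D_j` of a Weyl algebra in which `X_i ^ p`
and `D_j ^ p` are scalars. -/
def weylRep (χ : Module.Dual k (gln k n)) (a b : Fin n → k)
    (hX : ∀ i, X i ^ p = algebraMap k A (a i ^ p)) (hD : ∀ i, D i ^ p = algebraMap k A (b i ^ p))
    (hχ : ∀ i j, χ (Matrix.single i j 1) = a i * b j) : GLReduced p χ →ₐ[k] A :=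
  ReducedEnveloping.lift
    { weylLinear X D with map_lie' := fun {x y} => weylLinear_lie hXX hDD hDX x y }
    (pow_sub_eq_of_single p _ χ fun i j => by
      have h2 : 2 ≤ p := (Fact.out : p.Prime).two_le
      change weylLinear X D _ ^ p - weylLinear X D _ = _
      rw [hχ, mul_pow, map_mul, ← hX, ← hD]
      -- A diagonal unit equals its own p-th power. An off-diagonal unit squares to zero, and there
      -- X_i and D_j commute.
      by_cases hij : i = j
      · subst hij
        rw [single_one_self_pow i (by omega), weylLinear_single]
        exact mul_pow_prime_of_commutator_eq_one (k := k) p (by simp [hDX])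
      · have hc : Commute (X i) (D j) := by
          have := hDX i j
          rw [if_neg hij, add_zero] at this
          exact this.symm
        rw [single_one_pow hij h2, map_zero, sub_zero, weylLinear_single, hc.mul_pow])

end WeylRep

/-! ### A Weyl algebra acting on functions on 𝔽_p^n -/

section TorusFunctions

variable (k : Type*) [Field k] (n p : ℕ)

/-- The shift operator on functions on `𝔽_p ^ n`. -/
def shiftOp (i : Fin n) : Module.End k ((Fin n → ZMod p) → k) where
  toFun φ m := φ (m + Pi.single i 1)
  map_add' _ _ := rfl
  map_smul' _ _ := rfl

variable {k n p}

theorem shiftOp_commute (i j : Fin n) : Commute (shiftOp k n p i) (shiftOp k n p j) := by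
  refine LinearMap.ext fun φ => funext fun m => ?_
  change φ _ = φ _
  rw [add_right_comm]

theorem shiftOp_pow (i : Fin n) : shiftOp k n p i ^ p = 1 := by
  have h : ∀ q : ℕ, ∀ φ m, (shiftOp k n p i ^ q) φ m = φ (m + Pi.single i (q : ZMod p)) := by
    intro q
    induction q with
    | zero => intro φ m; simp
    | succ q ih =>
      intro φ m
      rw [pow_succ', Module.End.mul_apply]
      change (shiftOp k n p i ^ q) φ (m + Pi.single i 1) = _
      rw [ih, add_assoc, ← Pi.single_add]
      push_cast
      rw [add_comm (1 : ZMod p)]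
  refine LinearMap.ext fun φ => funext fun m => ?_
  rw [h]
  simp

variable (k n p)
variable [Fact p.Prime] [CharP k p]

/-- The operator adjoint to the shift with respect to the Weyl relations. -/
def coshiftOp (i : Fin n) : Module.End k ((Fin n → ZMod p) → k) where
  toFun φ m := ZMod.castHom (dvd_refl p) k (m i) * φ (m - Pi.single i 1)
  map_add' φ ψ := by ext m; simp [mul_add]
  map_smul' c φ := by ext m; simp [mul_left_comm]

variable {k n p}

theorem coshiftOp_commute (i j : Fin n) : Commute (coshiftOp k n p i) (coshiftOp k n p j) := by
  rcases eq_or_ne i j with rfl | h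
  · exact Commute.refl _
  refine LinearMap.ext fun φ => funext fun m => ?_
  change ZMod.castHom _ k (m i) * (ZMod.castHom _ k ((m - Pi.single i 1 : Fin n → ZMod p) j) * φ _)
    = ZMod.castHom _ k (m j) * (ZMod.castHom _ k ((m - Pi.single j 1 : Fin n → ZMod p) i) * φ _)
  rw [sub_right_comm, Pi.sub_apply, Pi.sub_apply, Pi.single_eq_of_ne h, Pi.single_eq_of_ne h.symm,
    sub_zero, sub_zero, mul_left_comm]

theorem shiftOp_mul_coshiftOp (i j : Fin n) : shiftOp k n p j * coshiftOp k n p i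
    = coshiftOp k n p i * shiftOp k n p j + if i = j then 1 else 0 := by
  refine LinearMap.ext fun φ => funext fun m => ?_
  have h : (coshiftOp k n p i * shiftOp k n p j) φ m
    = ZMod.castHom (dvd_refl p) k (m i) * φ (m - Pi.single i 1 + Pi.single j 1) := rfl
  have h2 : (shiftOp k n p j * coshiftOp k n p i) φ m
    = ZMod.castHom (dvd_refl p) k ((m + Pi.single j 1 : Fin n → ZMod p) i)
      * φ (m + Pi.single j 1 - Pi.single i 1) := rfl
  rw [LinearMap.add_apply, Pi.add_apply, h, h2, Pi.add_apply, sub_add_eq_add_sub]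
  split_ifs with hij
  · subst hij
    simp [add_mul]
  · simp [Pi.single_eq_of_ne hij]

/-- The p-th iterate carries the factor ∏(m_i − a) over all residues a, one of which is zero. -/
theorem coshiftOp_pow (i : Fin n) : coshiftOp k n p i ^ p = 0 := by
  have h : ∀ q : ℕ, ∀ φ m, (coshiftOp k n p i ^ q) φ m
      = ZMod.castHom (dvd_refl p) k (∏ a ∈ Finset.range q, (m i - (a : ZMod p)))
        * φ (m - Pi.single i (q : ZMod p)) := by
    intro q
    induction q with
    | zero => intro φ m; simp
    | succ q ih =>
      intro φ m
      rw [pow_succ', Module.End.mul_apply]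
      change ZMod.castHom _ k (m i) * (coshiftOp k n p i ^ q) φ (m - Pi.single i 1) = _
      rw [ih, Finset.prod_range_succ', sub_sub, ← Pi.single_add, map_mul]
      push_cast
      rw [add_comm (1 : ZMod p), ← mul_assoc, mul_comm (ZMod.castHom _ k (m i)), sub_zero]
      congr 3
      refine Finset.prod_congr rfl fun a _ => ?_
      rw [Pi.sub_apply, Pi.single_eq_same, sub_sub, add_comm (1 : ZMod p)]
  refine LinearMap.ext fun φ => funext fun m => ?_
  rw [h, Finset.prod_eq_zero (i := (m i).val)]
  · simp
  · exact Finset.mem_range.mpr (ZMod.val_lt _)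
  · simp

end TorusFunctions

/-! ### Nonzero modules for every p-character -/

section Existence

universe u

variable {k : Type u} [Field k] {n p : ℕ} [Fact p.Prime] [CharP k p]

variable (p) in
/-- There is a nonzero `U_χ(𝔤𝔩_n)`-module. -/
def HasModule (χ : Module.Dual k (gln k n)) : Prop :=
  ∃ (M : Type u) (_ : AddCommGroup M) (_ : Module k M),
    Nontrivial M ∧ Nonempty (GLReduced p χ →ₐ[k] Module.End k M)

/-- Adding scalars preserves the Weyl relations and adds their p-th powers to those of the
operators. The coshift has p-th power 0 and the shift has p-th power 1, hence the scalars a_i and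
b_i − 1. -/
theorem hasModule_rankOne (χ : Module.Dual k (gln k n)) (a b : Fin n → k)
    (hχ : ∀ i j, χ (Matrix.single i j 1) = a i * b j) : HasModule p χ := by
  refine ⟨(Fin n → ZMod p) → k, inferInstance, inferInstance, inferInstance, ⟨?_⟩⟩
  have hc : ∀ c : k, ∀ z : Module.End k ((Fin n → ZMod p) → k),
    Commute (algebraMap k _ c) z := fun c z => Algebra.commutes c z
  have hp0 : p ≠ 0 := (Fact.out : p.Prime).ne_zero
  have hA : CharP (Module.End k ((Fin n → ZMod p) → k)) p := charP_of_injective_algebraMap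
    (algebraMap k (Module.End k ((Fin n → ZMod p) → k))).injective p
  refine weylRep (X := fun i => coshiftOp k n p i + algebraMap k _ (a i))
    (D := fun i => shiftOp k n p i + algebraMap k _ (b i - 1)) ?_ ?_ ?_ p χ a b ?_ ?_ hχ
  · exact fun i j => ((coshiftOp_commute i j).add_left (hc _ _)).add_right
      ((hc _ _).symm)
  · exact fun i j => ((shiftOp_commute i j).add_left (hc _ _)).add_right
      ((hc _ _).symm)
  · intro i j
    have h1 := shiftOp_mul_coshiftOp (k := k) (p := p) i j
    simp only [add_mul, mul_add, h1, (hc (a i) (shiftOp k n p j)).eq,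
      (hc (b j - 1) (coshiftOp k n p i)).eq, (hc (b j - 1) (algebraMap k _ (a i))).eq]
    abel
  · intro i
    rw [add_pow_char_of_commute _ (hc _ _).symm, coshiftOp_pow, zero_add, map_pow]
  · intro i
    rw [add_pow_char_of_commute _ (hc _ _).symm, shiftOp_pow, ← map_pow, sub_pow_char, one_pow,
      map_sub, map_one, add_sub_cancel]

theorem HasModule.add {χ χ' : Module.Dual k (gln k n)} (h : HasModule p χ) (h' : HasModule p χ') :
    HasModule p (χ + χ') := by
  obtain ⟨M, _, _, hM, ⟨σ⟩⟩ := h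
  obtain ⟨N, _, _, hN, ⟨τ⟩⟩ := h'
  exact ⟨M ⊗[k] N, inferInstance, inferInstance, inferInstance, ⟨tensorRep rfl σ τ⟩⟩

/-- Tensor products add p-characters, and every form is a sum of forms of rank one. -/
theorem hasModule (χ : Module.Dual k (gln k n)) : HasModule p χ := by
  have hχ : χ = ∑ i, ∑ j, χ (Matrix.single i j 1) • Matrix.entryLinearMap k k i j := by
    refine LinearMap.ext fun x => ?_
    conv_lhs => rw [Matrix.matrix_eq_sum_single x]
    simp only [map_sum, LinearMap.sum_apply, LinearMap.smul_apply, Matrix.entryLinearMap_apply]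
    refine Finset.sum_congr rfl fun i _ => Finset.sum_congr rfl fun j _ => ?_
    have : (Matrix.single i j (x i j) : gln k n) = x i j • Matrix.single i j 1 := by simp
    rw [this, map_smul, smul_eq_mul, smul_eq_mul, mul_comm]
  have h0 : HasModule p (0 : Module.Dual k (gln k n)) :=
    hasModule_rankOne 0 0 0 fun i j => by simp
  rw [hχ]
  refine Finset.sum_induction _ (HasModule p) (fun _ _ => HasModule.add) h0 fun i _ =>
    Finset.sum_induction _ (HasModule p) (fun _ _ => HasModule.add) h0 fun j _ => ?_
  refine hasModule_rankOne _ (Pi.single i (χ (Matrix.single i j 1))) (Pi.single j 1) fun a b => ?_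
  rw [LinearMap.smul_apply, Matrix.entryLinearMap_apply, smul_eq_mul, Matrix.single_apply]
  by_cases h1 : a = i <;> by_cases h2 : b = j <;> simp [h1, h2]

end Existence

/-! ### Engel's theorem for representations by nilpotent operators -/

section Engel

variable {k : Type*} [Field k] {L : Type*} [LieRing L] [LieAlgebra k L] [Module.Finite k L]
  {M : Type*} [AddCommGroup M] [Module k M]

theorem exists_ne_zero_forall_apply_eq_zero [Nontrivial M] (g : L →ₗ⁅k⁆ Module.End k M)
    (hg : ∀ x, IsNilpotent (g x)) : ∃ v, v ≠ 0 ∧ ∀ x, g x v = 0 := by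
  let _ := LieRingModule.compLieHom M g
  have := LieModule.compLieHom M g
  have hN : LieModule.IsNilpotent L M :=
    LieAlgebra.isEngelian_of_isNoetherian (R := k) (L := L) M fun x => hg x
  have := LieModule.nontrivial_max_triv_of_isNilpotent k L M
  obtain ⟨⟨v, hv⟩, hne⟩ := exists_ne (0 : LieModule.maxTrivSubmodule k L M)
  exact ⟨v, fun h => hne (Subtype.ext h), fun x => hv x⟩

/-- By Engel the lower central series of M reaches 0, whereas LM = M keeps it equal to M. Only L has
to be finite-dimensional. -/
theorem subsingleton_of_iSup_range_eq_top (g : L →ₗ⁅k⁆ Module.End k M)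
    (hg : ∀ x, IsNilpotent (g x)) (h : ⨆ x, LinearMap.range (g x) = ⊤) : Subsingleton M := by
  let _ := LieRingModule.compLieHom M g
  have := LieModule.compLieHom M g
  have hN : LieModule.IsNilpotent L M :=
    LieAlgebra.isEngelian_of_isNoetherian (R := k) (L := L) M fun x => hg x
  have h1 : ⁅(⊤ : LieIdeal k L), (⊤ : LieSubmodule k L M)⁆ = ⊤ := by
    rw [eq_top_iff, ← LieSubmodule.toSubmodule_le_toSubmodule, LieSubmodule.top_toSubmodule, ← h]
    refine iSup_le fun x => ?_
    rintro _ ⟨m, rfl⟩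
    exact LieSubmodule.lie_mem_lie (I := (⊤ : LieIdeal k L)) (N := (⊤ : LieSubmodule k L M))
      (LieSubmodule.mem_top x) (LieSubmodule.mem_top m)
  have h2 : ∀ m, LieModule.lowerCentralSeries k L M m = ⊤ := by
    intro m
    induction m with
    | zero => rfl
    | succ m ih => rw [LieModule.lowerCentralSeries_succ, ih, h1]
  obtain ⟨m, hm⟩ := LieModule.IsNilpotent.nilpotent k L M
  rw [h2] at hm
  exact (LieSubmodule.subsingleton_iff k L M).mp (subsingleton_of_top_le_bot hm.le)

end Engel

/-! ### Strictly triangular matrices -/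

section StrictTriangular

variable (k : Type*) [Field k] (n : ℕ)

/-- The Lie subalgebra of matrices supported on a transitive relation. -/
def supportedSubalgebra (r : Fin n → Fin n → Prop) [IsTrans (Fin n) r] :
    LieSubalgebra k (gln k n) where
  carrier := {x | ∀ i j, ¬ r i j → x i j = 0}
  add_mem' := fun {x y} hx hy i j h => by simp [hx i j h, hy i j h]
  zero_mem' := fun i j _ => rfl
  smul_mem' := fun c x hx i j h => by simp [hx i j h]
  lie_mem' := fun {x y} hx hy => by
    have key : ∀ {x y : gln k n}, (∀ i j, ¬ r i j → x i j = 0) → (∀ i j, ¬ r i j → y i j = 0) →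
        ∀ i j, ¬ r i j → (x * y) i j = 0 := by
      intro x y hx hy i j h
      rw [Matrix.mul_apply]
      refine Finset.sum_eq_zero fun a _ => ?_
      by_cases h1 : r i a
      · rw [hy a j fun h2 => h (_root_.trans h1 h2), mul_zero]
      · rw [hx i a h1, zero_mul]
    intro i j h
    rw [LieRing.of_associative_ring_bracket, Matrix.sub_apply, key hx hy i j h, key hy hx i j h,
      sub_zero]

variable {k n}

theorem pow_eq_zero_of_strictUpper {x : gln k n} (hx : ∀ i j, ¬ i < j → x i j = 0) :
    x ^ n = 0 := by
  have h : x.charpoly = Polynomial.X ^ n := by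
    rw [Matrix.charpoly_of_isUpperTriangular x fun i j hij => hx i j (lt_asymm hij),
      Finset.prod_congr rfl fun i _ => by rw [hx i i (lt_irrefl i), map_zero, sub_zero]]
    simp
  have := Matrix.aeval_self_charpoly x
  rwa [h, map_pow, Polynomial.aeval_X] at this

theorem pow_eq_zero_of_strictLower {x : gln k n} (hx : ∀ i j, ¬ i > j → x i j = 0) :
    x ^ n = 0 := by
  have h : x.transpose ^ n = 0 := pow_eq_zero_of_strictUpper fun i j hij => hx j i hij
  rw [← Matrix.transpose_pow] at h
  exact Matrix.transpose_eq_zero.mp h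

theorem pow_apply_eq_zero_of_strictLower {x : gln k n} (hx : ∀ i j, ¬ i > j → x i j = 0) (m : ℕ)
    (i j : Fin n) (hij : (i : ℕ) ≤ j + m) : (x ^ (m + 1)) i j = 0 := by
  induction m generalizing i j with
  | zero =>
    rw [zero_add, pow_one]
    exact hx i j (by rw [gt_iff_lt, Fin.lt_def]; omega)
  | succ m ih =>
    rw [pow_succ, Matrix.mul_apply]
    refine Finset.sum_eq_zero fun a _ => ?_
    by_cases h : a > j
    · rw [ih i a (by rw [gt_iff_lt, Fin.lt_def] at h; omega), zero_mul]
    · rw [hx a j h, mul_zero]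

end StrictTriangular

/-! ### Existence of singular vectors -/

section Singular

variable {k : Type*} [Field k] {n p : ℕ} {M : Type*} [AddCommGroup M] [Module k M]

/-- The Lie algebra action of `𝔤𝔩_n` underlying a `U_χ(𝔤𝔩_n)`-module. -/
def actHom {χ : Module.Dual k (gln k n)} (σ : GLReduced p χ →ₐ[k] Module.End k M) :
    gln k n →ₗ⁅k⁆ Module.End k M :=
  (σ : GLReduced p χ →ₗ⁅k⁆ Module.End k M).comp (ReducedEnveloping.incl p (glPow p) χ)

theorem actHom_apply {χ : Module.Dual k (gln k n)} (σ : GLReduced p χ →ₐ[k] Module.End k M)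
    (x : gln k n) : actHom σ x = σ (ReducedEnveloping.incl p (glPow p) χ x) := rfl

theorem actHom_pow {χ : Module.Dual k (gln k n)} (σ : GLReduced p χ →ₐ[k] Module.End k M)
    (x : gln k n) : actHom σ x ^ p = actHom σ (x ^ p) + algebraMap k _ (χ x ^ p) := by
  have := congrArg σ (ReducedEnveloping.incl_pow p (glPow p) χ x)
  rw [map_sub, map_pow, AlgHom.commutes, sub_eq_iff_eq_add'] at this
  exact this

theorem single_lie_single (i j a b : Fin n) :
    ⁅(Matrix.single i j (1 : k)), Matrix.single a b (1 : k)⁆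
      = (if j = a then Matrix.single i b 1 else 0) - if b = i then Matrix.single a j 1 else 0 := by
  rw [LieRing.of_associative_ring_bracket]
  congr 1
  · split_ifs with h
    · subst h; simp
    · exact Matrix.single_mul_single_of_ne _ _ _ _ h _
  · split_ifs with h
    · subst h; simp
    · exact Matrix.single_mul_single_of_ne _ _ _ _ h _

theorem LieHom.map_single_mul_single (f : gln k n →ₗ⁅k⁆ Module.End k M) (i j a b : Fin n) (v : M) :
    f (Matrix.single i j 1) (f (Matrix.single a b 1) v)
      = f (Matrix.single a b 1) (f (Matrix.single i j 1) v)
        + ((if j = a then f (Matrix.single i b 1) v else 0)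
          - if b = i then f (Matrix.single a j 1) v else 0) := by
  have h := f.map_lie (Matrix.single i j 1) (Matrix.single a b 1)
  rw [single_lie_single, LieRing.of_associative_ring_bracket, map_sub] at h
  replace h := LinearMap.congr_fun h v
  rw [LinearMap.sub_apply, LinearMap.sub_apply, Module.End.mul_apply, Module.End.mul_apply] at h
  rw [add_comm, ← sub_eq_iff_eq_add, ← h]
  congr 1 <;> split_ifs <;> simp

variable [Fact p.Prime] [CharP k p]

/-- The first p-th power absorbs the scalar χ(x); later ones create none, because χ vanishes on the
higher powers of x. -/
theorem actHom_sub_pow_pow {χ : Module.Dual k (gln k n)} (σ : GLReduced p χ →ₐ[k] Module.End k M)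
    (x : gln k n) (hx : ∀ m, 2 ≤ m → χ (x ^ m) = 0) (s : ℕ) :
    (actHom σ x - algebraMap k _ (χ x)) ^ p ^ (s + 1) = actHom σ (x ^ p ^ (s + 1)) := by
  have hp : p.Prime := Fact.out
  cases subsingleton_or_nontrivial M
  · exact Subsingleton.elim _ _
  have hA : CharP (Module.End k M) p :=
    charP_of_injective_algebraMap (algebraMap k (Module.End k M)).injective p
  induction s with
  | zero =>
    rw [zero_add, pow_one, sub_pow_char_of_commute _ (Algebra.commute_algebraMap_right _ _),
      actHom_pow, map_pow (algebraMap k (Module.End k M)), add_sub_cancel_right]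
  | succ s ih =>
    rw [pow_succ, pow_mul, ih, actHom_pow, ← pow_mul, hx, zero_pow hp.ne_zero, map_zero, add_zero]
    exact hp.two_le.trans (Nat.le_self_pow (Nat.succ_ne_zero s) p)

theorem isNilpotent_actHom_sub {χ : Module.Dual k (gln k n)}
    (σ : GLReduced p χ →ₐ[k] Module.End k M) (x : gln k n) (hx : ∀ m, 2 ≤ m → χ (x ^ m) = 0)
    (hn : x ^ n = 0) : IsNilpotent (actHom σ x - algebraMap k _ (χ x)) := by
  refine ⟨p ^ (n + 1), ?_⟩
  have h : n ≤ p ^ (n + 1) :=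
    (Nat.le_succ n).trans (Nat.lt_pow_self (Fact.out : p.Prime).one_lt).le
  rw [actHom_sub_pow_pow σ x hx, pow_eq_zero_of_le h hn, map_zero]

/-- `v` is annihilated by `𝔫⁺` and has weight `l`. -/
structure IsSingular (f : gln k n →ₗ⁅k⁆ Module.End k M) (l : Fin n → ZMod p) (v : M) : Prop where
  upper : ∀ i j, i < j → f (Matrix.single i j 1) v = 0
  diag : ∀ i, f (Matrix.single i i 1) v = ZMod.castHom (dvd_refl p) k (l i) • v

/-- Since T^p − T = ∏(T − i) annihilates h, applying the factors h − i in turn ends in zero, and the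
last nonzero vector is an eigenvector. -/
theorem exists_eigenvector_of_pow_prime_eq_self (h : Module.End k M) (hh : h ^ p = h)
    (W : Submodule k M) (hW : ∀ w ∈ W, h w ∈ W) {v : M} (hv : v ∈ W) (hv0 : v ≠ 0) :
    ∃ c : ZMod p, ∃ w ∈ W, w ≠ 0 ∧ h w = ZMod.castHom (dvd_refl p) k c • w := by
  have key : ∀ m : ℕ, ∀ v ∈ W, v ≠ 0 →
      Polynomial.aeval h (∏ i ∈ Finset.range m, (Polynomial.X - Polynomial.C (i : k))) v = 0 →
      ∃ c : ZMod p, ∃ w ∈ W, w ≠ 0 ∧ h w = ZMod.castHom (dvd_refl p) k c • w := by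
    intro m
    induction m with
    | zero =>
      intro v _ hv0 h0
      simp only [Finset.range_zero, Finset.prod_empty, map_one, Module.End.one_apply] at h0
      exact absurd h0 hv0
    | succ m ih =>
      intro v hv hv0 h0
      by_cases h1 : h v - (m : k) • v = 0
      · exact ⟨m, v, hv, hv0, by rw [map_natCast]; exact sub_eq_zero.mp h1⟩
      · refine ih _ (W.sub_mem (hW v hv) (W.smul_mem _ hv)) h1 ?_
        rw [Finset.prod_range_succ, map_mul, Module.End.mul_apply] at h0
        simpa [Nat.cast_smul_eq_nsmul] using h0
  refine key p v hv hv0 ?_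
  rw [prod_range_prime_X_sub_natCast, map_sub, map_pow, Polynomial.aeval_X, hh, sub_self,
    LinearMap.zero_apply]

theorem exists_isSingular [Nontrivial M] {χ : Module.Dual k (gln k n)}
    (hχ : ∀ x ∈ upperBorel k n, χ x = 0) (σ : GLReduced p χ →ₐ[k] Module.End k M) :
    ∃ l : Fin n → ZMod p, ∃ v, v ≠ 0 ∧ IsSingular (actHom σ) l v := by
  set f := actHom σ with hf
  obtain ⟨v₀, hv₀, h₀⟩ := exists_ne_zero_forall_apply_eq_zero
    (f.comp (supportedSubalgebra k n (· < ·)).incl) (fun x => by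
      have hx := x.2
      have hB : ∀ m, (x : gln k n) ^ m ∈ upperBorel k n := fun m =>
        upperBorel_pow_mem m fun i j hij => hx i j (lt_asymm hij)
      have h := isNilpotent_actHom_sub σ (x : gln k n) (fun m _ => hχ _ (hB m))
        (pow_eq_zero_of_strictUpper hx)
      have h1 := hχ _ (hB 1)
      rw [pow_one] at h1
      rwa [h1, map_zero, sub_zero] at h)
  -- Engel's theorem has given a vector killed by 𝔫⁺. The diagonal units are now diagonalised one at
  -- a time, inside the space of vectors that are already good for `s`.
  have hs : ∀ s : Finset (Fin n), ∃ l : Fin n → ZMod p, ∃ v, v ≠ 0 ∧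
      (∀ i j, i < j → f (Matrix.single i j 1) v = 0) ∧
      ∀ i ∈ s, f (Matrix.single i i 1) v = ZMod.castHom (dvd_refl p) k (l i) • v := by
    intro s
    induction s using Finset.induction_on with
    | empty =>
      refine ⟨0, v₀, hv₀, fun i j hij => ?_, by simp⟩
      refine h₀ ⟨Matrix.single i j 1, fun a b hab => ?_⟩
      rw [Matrix.single_apply, if_neg]
      rintro ⟨rfl, rfl⟩
      exact hab hij
    | insert a s ha ih =>
      obtain ⟨l, v, hv, hu, hd⟩ := ih
      let W : Submodule k M :=
        { carrier := {w | (∀ i j, i < j → f (Matrix.single i j 1) w = 0) ∧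
            ∀ i ∈ s, f (Matrix.single i i 1) w = ZMod.castHom (dvd_refl p) k (l i) • w}
          add_mem' := fun {x y} hx hy => ⟨fun i j h => by rw [map_add, hx.1 i j h, hy.1 i j h,
            add_zero], fun i h => by rw [map_add, hx.2 i h, hy.2 i h, smul_add]⟩
          zero_mem' := by simp
          smul_mem' := fun c x hx => ⟨fun i j h => by rw [map_smul, hx.1 i j h, smul_zero],
            fun i h => by rw [map_smul, hx.2 i h, smul_comm]⟩ }
      have hpow : f (Matrix.single a a 1) ^ p = f (Matrix.single a a 1) := by
        rw [hf, actHom_pow, single_one_self_pow a (Fact.out : p.Prime).ne_zero, hχ,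
          zero_pow (Fact.out : p.Prime).ne_zero, map_zero, add_zero]
        intro i j hij
        rw [Matrix.single_apply, if_neg]
        rintro ⟨rfl, rfl⟩
        exact lt_irrefl _ hij
      obtain ⟨c, w, hw, hw0, hc⟩ := exists_eigenvector_of_pow_prime_eq_self
        (f (Matrix.single a a 1)) hpow W (fun w hw => by
          refine ⟨fun i j hij => ?_, fun i hi => ?_⟩
          · rw [f.map_single_mul_single, hw.1 i j hij, map_zero, zero_add]
            split_ifs with h1 h2 h2
            · exact absurd (h1.trans h2) hij.ne'
            · subst h1; rw [hw.1 _ _ hij, sub_zero]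
            · subst h2; rw [hw.1 _ _ hij, sub_zero]
            · exact sub_zero _
          · rw [f.map_single_mul_single, hw.2 i hi, map_smul]
            split_ifs with h1 h2 h2
            · subst h1; simp
            · exact absurd h1.symm h2
            · exact absurd h2.symm h1
            · simp) (v := v) ⟨hu, hd⟩ hv
      refine ⟨Function.update l a c, w, hw0, hw.1, fun i hi => ?_⟩
      rcases eq_or_ne i a with rfl | hne
      · rw [Function.update_self, hc]
      · rw [Function.update_of_ne hne]
        exact hw.2 i ((Finset.mem_insert.mp hi).resolve_left hne)
  obtain ⟨l, v, hv, hu, hd⟩ := hs Finset.univ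
  exact ⟨l, v, hv, hu, fun i => hd i (Finset.mem_univ i)⟩

end Singular

/-! ### Simple reflections -/

section Reflection

variable {k : Type*} [Field k] {n p : ℕ} [CharP k p]
  {M : Type*} [AddCommGroup M] [Module k M]

namespace IsSingular

variable {f : gln k n →ₗ⁅k⁆ Module.End k M} {l : Fin n → ZMod p} {v : M} {i j : Fin n}

theorem diag_lowering (h : IsSingular f l v) (r : ℕ) (a : Fin n) :
    f (Matrix.single a a 1) ((f (Matrix.single j i 1) ^ r) v)
      = ZMod.castHom (dvd_refl p) k
          (l a + (if a = j then (r : ZMod p) else 0) - if a = i then (r : ZMod p) else 0)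
        • (f (Matrix.single j i 1) ^ r) v := by
  induction r with
  | zero => simpa using h.diag a
  | succ r ih =>
    rw [pow_succ', Module.End.mul_apply, f.map_single_mul_single, ih, map_smul]
    set w := f (Matrix.single j i 1) ((f (Matrix.single j i 1) ^ r) v) with hw
    have h1 : (if a = j then f (Matrix.single a i 1) ((f (Matrix.single j i 1) ^ r) v) else 0)
        = (if a = j then (1 : k) else 0) • w := by
      split_ifs with h
      · rw [one_smul, h]
      · rw [zero_smul]
    have h2 : (if i = a then f (Matrix.single j a 1) ((f (Matrix.single j i 1) ^ r) v) else 0)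
        = (if a = i then (1 : k) else 0) • w := by
      by_cases h : a = i
      · rw [if_pos h.symm, if_pos h, one_smul, h]
      · rw [if_neg (Ne.symm h), if_neg h, zero_smul]
    rw [h1, h2, ← sub_smul, ← add_smul]
    congr 1
    push_cast
    split_ifs <;> simp only [map_add, map_sub, map_zero, map_one] <;> ring

/-- For adjacent i, j, commuting E_ab past E_ji produces only units above the diagonal other than
E_ij, so the induction closes. -/
theorem upper_lowering (h : IsSingular f l v) (hij : (j : ℕ) = i + 1) (r : ℕ) (a b : Fin n)
    (hab : a < b) (hne : ¬ (a = i ∧ b = j)) :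
    f (Matrix.single a b 1) ((f (Matrix.single j i 1) ^ r) v) = 0 := by
  induction r generalizing a b with
  | zero => exact h.upper a b hab
  | succ r ih =>
    rw [pow_succ', Module.End.mul_apply, f.map_single_mul_single, ih a b hab hne, map_zero, zero_add]
    rw [Fin.lt_def] at hab
    have h1 : (if b = j then f (Matrix.single a i 1) ((f (Matrix.single j i 1) ^ r) v) else 0)
        = 0 := by
      split_ifs with hb
      · have hai : (a : ℕ) ≠ i := fun h => hne ⟨Fin.ext h, hb⟩
        subst hb
        refine ih a i (by rw [Fin.lt_def]; omega) ?_
        rintro ⟨h, -⟩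
        exact hai (congrArg _ h)
      · rfl
    have h2 : (if i = a then f (Matrix.single j b 1) ((f (Matrix.single j i 1) ^ r) v) else 0)
        = 0 := by
      split_ifs with ha
      · have hbj : (b : ℕ) ≠ j := fun h => hne ⟨ha.symm, Fin.ext h⟩
        subst ha
        refine ih j b (by rw [Fin.lt_def]; omega) ?_
        rintro ⟨-, h⟩
        exact hbj (congrArg _ h)
      · rfl
    rw [h1, h2, sub_zero]

theorem raising_lowering (h : IsSingular f l v) (hij : (j : ℕ) = i + 1) (r : ℕ) :
    f (Matrix.single i j 1) ((f (Matrix.single j i 1) ^ (r + 1)) v)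
      = ZMod.castHom (dvd_refl p) k ((r + 1) * (l i - l j - r))
        • (f (Matrix.single j i 1) ^ r) v := by
  have hne : i ≠ j := fun h => by subst h; omega
  induction r with
  | zero =>
    rw [zero_add, pow_one, pow_zero, f.map_single_mul_single, if_pos rfl, if_pos rfl,
      h.upper i j (by rw [Fin.lt_def]; omega), h.diag, h.diag, map_zero, zero_add, ← sub_smul]
    simp
  | succ r ih =>
    rw [pow_succ', Module.End.mul_apply, f.map_single_mul_single, ih, if_pos rfl, if_pos rfl,
      diag_lowering h, diag_lowering h, map_smul, if_neg hne, if_pos rfl, if_pos rfl,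
      if_neg hne.symm, ← Module.End.mul_apply, ← pow_succ', ← sub_smul, ← add_smul, ← map_sub,
      ← map_add]
    congr 2
    push_cast
    ring

/-- The residue of r is the one that kills the 𝔰𝔩₂ coefficient in `raising_lowering`. -/
theorem lowering (h : IsSingular f l v) (hij : (j : ℕ) = i + 1) {r : ℕ}
    (hr : (r : ZMod p) = l i - l j + 1) :
    IsSingular f (fun a => l a + (if a = j then (r : ZMod p) else 0)
      - if a = i then (r : ZMod p) else 0) ((f (Matrix.single j i 1) ^ r) v) where
  upper a b hab := by
    by_cases hne : a = i ∧ b = j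
    · obtain ⟨rfl, rfl⟩ := hne
      cases r with
      | zero => exact h.upper _ _ hab
      | succ r =>
        rw [h.raising_lowering hij]
        have : l a - l b - r = 0 := by
          push_cast at hr
          rw [sub_eq_zero]
          exact (add_right_cancel hr).symm
        rw [this, mul_zero, map_zero, zero_smul]
    · exact h.upper_lowering hij r a b hab hne
  diag a := h.diag_lowering r a

end IsSingular

variable [Fact p.Prime]

theorem regularNilpotent_single {i j : Fin n} :
    regularNilpotent k n (Matrix.single i j 1) = if (i : ℕ) = j + 1 then 1 else 0 := by
  change ∑ a : Fin n, ∑ b : Fin n,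
    (if (a : ℕ) = (b : ℕ) + 1 then (Matrix.single i j (1 : k)) a b else 0) = _
  rw [Finset.sum_eq_single i, Finset.sum_eq_single j]
  · simp
  · intro b _ hb
    simp [hb.symm]
  · simp
  · intro a _ ha
    refine Finset.sum_eq_zero fun b _ => ?_
    simp [ha.symm]
  · simp

/-- The module has a nonzero singular vector of weight `x - ρ`. -/
def HasSingular {χ : Module.Dual k (gln k n)} (σ : GLReduced p χ →ₐ[k] Module.End k M)
    (x : Fin n → ZMod p) : Prop :=
  ∃ v, v ≠ 0 ∧ IsSingular (actHom σ) (x - weylRho) v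

variable {σ : GLReduced p (regularNilpotent k n) →ₐ[k] Module.End k M}

/-- Because χ(E_ji) = 1, the p-th power of E_ji acts as 1. So E_ji^r kills no nonzero vector for r <
p, and the reflected singular vector never vanishes. -/
theorem HasSingular.swap {x : Fin n → ZMod p} (h : HasSingular σ x) {i j : Fin n}
    (hij : (j : ℕ) = i + 1) : HasSingular σ (x ∘ Equiv.swap i j) := by
  obtain ⟨v, hv, hs⟩ := h
  set r := (x i - x j).val with hr
  have hr' : (r : ZMod p) = x i - x j := ZMod.natCast_zmod_val _
  have hne : i ≠ j := fun h => by subst h; omega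
  refine ⟨(actHom σ (Matrix.single j i 1) ^ r) v, fun h0 => hv ?_, ?_⟩
  · have h1 := LinearMap.congr_fun (actHom_pow σ (Matrix.single j i 1)) v
    have h2 : actHom σ (Matrix.single j i 1) ^ p = actHom σ (Matrix.single j i 1) ^ (p - r)
        * actHom σ (Matrix.single j i 1) ^ r := by
      rw [← pow_add, Nat.sub_add_cancel (ZMod.val_lt _).le]
    rw [single_one_pow hne.symm (Fact.out : p.Prime).two_le, map_zero, zero_add,
      regularNilpotent_single, if_pos hij, one_pow, map_one, Module.End.one_apply, h2,
      Module.End.mul_apply, h0, map_zero] at h1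
    exact h1.symm
  -- As ρ_i − ρ_j = 1 for neighbours, r ≡ x_i − x_j is the exponent l_i − l_j + 1 required by
  -- `lowering`.
  · have hρ : (weylRho i - weylRho j : ZMod p) = 1 := by
      unfold weylRho
      rw [hij]
      push_cast
      ring
    convert hs.lowering hij (r := r) ?_ using 1
    · funext a
      rw [hr', Pi.sub_apply, Pi.sub_apply, Function.comp_apply]
      rcases eq_or_ne a i with rfl | hi
      · rw [Equiv.swap_apply_left, if_neg hne, if_pos rfl]
        ring
      · rcases eq_or_ne a j with rfl | hj
        · rw [Equiv.swap_apply_right, if_neg hi, if_pos rfl]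
          ring
        · rw [Equiv.swap_apply_of_ne_of_ne hi hj, if_neg hi, if_neg hj]
          ring
    · rw [hr', Pi.sub_apply, Pi.sub_apply, ← hρ]
      ring

theorem HasSingular.comp_perm {x : Fin n → ZMod p} (h : HasSingular σ x)
    (w : Equiv.Perm (Fin n)) : HasSingular σ (x ∘ w) := by
  cases n with
  | zero => rwa [Subsingleton.elim (x ∘ w) x]
  | succ n =>
    have hw : w ∈ Submonoid.closure
        (Set.range fun i : Fin n => Equiv.swap i.castSucc i.succ) := by
      rw [Equiv.Perm.mclosure_swap_castSucc_succ]
      trivial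
    induction hw using Submonoid.closure_induction generalizing x with
    | mem w hw =>
      obtain ⟨i, rfl⟩ := hw
      exact h.swap (by simp)
    | one => exact h
    | mul w₁ w₂ _ _ h₁ h₂ => exact h₂ (h₁ h)

end Reflection

/-! ### Tensoring with the natural module -/

section Natural

variable (k : Type*) [Field k] (n p : ℕ) [Fact p.Prime]

/-- The natural module `k ^ n` of `U_0(𝔤𝔩_n)`. -/
def natRep : GLReduced p (0 : Module.Dual k (gln k n)) →ₐ[k] Module.End k (Fin n → k) :=
  ReducedEnveloping.lift
    ((Matrix.toLinAlgEquiv' : Matrix (Fin n) (Fin n) k ≃ₐ[k] _).toAlgHom :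
      gln k n →ₗ⁅k⁆ Module.End k (Fin n → k))
    (fun x => by
      change Matrix.toLinAlgEquiv' x ^ p - Matrix.toLinAlgEquiv' (x ^ p) = _
      rw [map_pow, sub_self, LinearMap.zero_apply, zero_pow (Fact.out : p.Prime).ne_zero, map_zero])

variable {k n p}

theorem natRep_incl (x : gln k n) (u : Fin n → k) :
    natRep k n p (ReducedEnveloping.incl p (glPow p) 0 x) u = x.mulVec u := by
  unfold natRep
  rw [ReducedEnveloping.lift_incl]
  exact Matrix.toLinAlgEquiv'_apply x u

variable [CharP k p] {M : Type*} [AddCommGroup M] [Module k M]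

/-- The first basis vector of k^n is itself singular, of weight ε_1, so v ⊗ e_1 is singular. -/
theorem HasSingular.tensor_natRep {χ : Module.Dual k (gln k n)}
    {σ : GLReduced p χ →ₐ[k] Module.End k M} {x : Fin n → ZMod p} (h : HasSingular σ x)
    {i : Fin n} (hi : (i : ℕ) = 0) :
    HasSingular (tensorRep (add_zero χ).symm σ (natRep k n p)) (x + Pi.single i 1) := by
  obtain ⟨v, hv, hs⟩ := h
  have key : ∀ a b, actHom (tensorRep (add_zero χ).symm σ (natRep k n p)) (Matrix.single a b 1)
      (v ⊗ₜ[k] Pi.single i 1) = actHom σ (Matrix.single a b 1) v ⊗ₜ[k] Pi.single i 1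
        + v ⊗ₜ[k] (if b = i then Pi.single a 1 else 0) := by
    intro a b
    rw [actHom_apply, tensorRep_incl, natRep_incl, ← actHom_apply]
    congr 2
    ext c
    by_cases hb : b = i
    · subst hb
      by_cases hc : a = c
      · subst hc; simp
      · simp [Ne.symm hc, hc]
    · simp [hb]
  refine ⟨v ⊗ₜ[k] Pi.single i 1, ?_, fun a b hab => ?_, fun a => ?_⟩
  · intro h0
    apply hv
    have := congrArg (TensorProduct.rid k M) (congrArg
      (LinearMap.lTensor M (LinearMap.proj (R := k) (φ := fun _ : Fin n => k) i)) h0)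
    simpa using this
  · have hb : b ≠ i := fun h => by
      subst h
      rw [Fin.lt_def] at hab
      omega
    rw [key, hs.upper a b hab, if_neg hb]
    simp
  · rw [key, hs.diag]
    rcases eq_or_ne a i with rfl | ha
    · rw [if_pos rfl, ← TensorProduct.smul_tmul', Pi.sub_apply, Pi.sub_apply, Pi.add_apply,
        Pi.single_eq_same, add_sub_right_comm, map_add, map_one, add_smul, one_smul]
    · rw [if_neg ha, TensorProduct.tmul_zero, add_zero, ← TensorProduct.smul_tmul', Pi.sub_apply,
        Pi.sub_apply, Pi.add_apply, Pi.single_eq_of_ne ha, add_zero]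

end Natural

/-! ### Every weight occurs -/

section AllWeights

universe u

variable {k : Type u} [Field k] {n p : ℕ} [Fact p.Prime] [CharP k p]

/-- Some `U_χ(𝔤𝔩_n)`-module, `χ` regular nilpotent, has a nonzero singular vector of weight
`x - ρ`. -/
def OccursSingular (k : Type u) [Field k] {n p : ℕ} [Fact p.Prime] [CharP k p]
    (x : Fin n → ZMod p) : Prop :=
  ∃ (M : Type u) (_ : AddCommGroup M) (_ : Module k M)
    (σ : GLReduced p (regularNilpotent k n) →ₐ[k] Module.End k M), HasSingular σ x

/-- Tensoring raises the first coordinate; permuting before and after by a transposition raises any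
other. -/
theorem OccursSingular.add_single {x : Fin n → ZMod p} (h : OccursSingular k x) (i : Fin n) :
    OccursSingular k (x + Pi.single i 1) := by
  obtain ⟨M, _, _, σ, hσ⟩ := h
  let i₀ : Fin n := ⟨0, i.pos⟩
  have h1 := ((hσ.comp_perm (Equiv.swap i i₀)).tensor_natRep (i := i₀) rfl).comp_perm
    (Equiv.swap i i₀)
  refine ⟨M ⊗[k] (Fin n → k), inferInstance, inferInstance,
    tensorRep (add_zero _).symm σ (natRep k n p), ?_⟩
  · convert h1 using 1
    funext a
    simp only [Pi.add_apply, Function.comp_apply, Equiv.swap_apply_self]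
    congr 1
    rcases eq_or_ne a i with rfl | ha
    · simp
    · rw [Pi.single_eq_of_ne ha, Pi.single_eq_of_ne]
      intro h
      rw [Equiv.swap_apply_eq_iff, Equiv.swap_apply_right] at h
      exact ha h

/-- One weight occurs because a nonzero module exists. Over 𝔽_p, raising coordinates by 1 repeatedly
leads from it to every other weight. -/
theorem occursSingular (x : Fin n → ZMod p) : OccursSingular k x := by
  obtain ⟨M, _, _, hM, ⟨σ⟩⟩ := hasModule (p := p) (regularNilpotent k n)
  obtain ⟨l, v, hv, hs⟩ := exists_isSingular (regularNilpotent_borel k n) σ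
  have h0 : OccursSingular k (l + weylRho) :=
    ⟨M, inferInstance, inferInstance, σ, v, hv, by rwa [add_sub_cancel_right]⟩
  have h1 : ∀ y : Fin n → ZMod p, OccursSingular k y → ∀ (i : Fin n) (m : ℕ),
      OccursSingular k (y + Pi.single i (m : ZMod p)) := by
    intro y hy i m
    induction m with
    | zero => simpa using hy
    | succ m ih =>
      have := ih.add_single i
      rwa [add_assoc, ← Pi.single_add, ← Nat.cast_succ] at this
  have h2 : ∀ s : Finset (Fin n), OccursSingular k
      (l + weylRho + ∑ i ∈ s, Pi.single i ((x - (l + weylRho) : Fin n → ZMod p) i)) := by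
    intro s
    induction s using Finset.induction_on with
    | empty => simpa using h0
    | insert a s ha ih =>
      have := h1 _ ih a ((x - (l + weylRho) : Fin n → ZMod p) a).val
      rw [ZMod.natCast_zmod_val, add_assoc, add_comm (∑ i ∈ s, _)] at this
      rwa [Finset.sum_insert ha]
  have h3 := h2 Finset.univ
  rwa [Finset.univ_sum_single, add_sub_cancel] at h3

end AllWeights

/-! ### Highest weight modules and baby Verma modules -/

section Generation

variable {k : Type*} [Field k] {L : Type*} [LieRing L] [LieAlgebra k L] {p : ℕ} {pm : L → L}
  {χ : Module.Dual k L}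

theorem ReducedEnveloping.hom_ext {A : Type*} [Ring A] [Algebra k A]
    {f g : ReducedEnveloping p pm χ →ₐ[k] A}
    (h : ∀ x, f (ReducedEnveloping.incl p pm χ x) = g (ReducedEnveloping.incl p pm χ x)) :
    f = g := by
  refine RingQuot.ringQuot_ext' k f g ?_
  refine UniversalEnvelopingAlgebra.hom_ext k (LieHom.ext fun x => ?_)
  exact h x

/-- The universal property gives a map into the generated subalgebra; followed by the inclusion, it
is the identity on generators, hence everywhere. -/
theorem ReducedEnveloping.adjoin_range_incl :
    Algebra.adjoin k (Set.range (ReducedEnveloping.incl p pm χ)) = ⊤ := by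
  set S := Algebra.adjoin k (Set.range (ReducedEnveloping.incl p pm χ)) with hS
  have hmem : ∀ x, ReducedEnveloping.incl p pm χ x ∈ S := fun x =>
    Algebra.subset_adjoin (Set.mem_range_self x)
  let f : L →ₗ⁅k⁆ S :=
    { toFun := fun x => ⟨ReducedEnveloping.incl p pm χ x, hmem x⟩
      map_add' := fun x y => Subtype.ext (map_add _ x y)
      map_smul' := fun c x => Subtype.ext (map_smul _ c x)
      map_lie' := fun {x y} => Subtype.ext (LieHom.map_lie _ x y) }
  let F : ReducedEnveloping p pm χ →ₐ[k] S := ReducedEnveloping.lift f fun x =>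
    Subtype.ext (ReducedEnveloping.incl_pow p pm χ x)
  have hF : S.val.comp F = AlgHom.id k _ := by
    refine ReducedEnveloping.hom_ext fun x => ?_
    rw [AlgHom.comp_apply, ReducedEnveloping.lift_incl]
    rfl
  refine eq_top_iff.mpr fun a _ => ?_
  have := AlgHom.congr_fun hF a
  rw [AlgHom.id_apply] at this
  rw [← this]
  exact (F a).2

theorem ReducedEnveloping.apply_mem {M : Type*} [AddCommGroup M] [Module k M]
    (σ : ReducedEnveloping p pm χ →ₐ[k] Module.End k M) (N : Submodule k M)
    (h : ∀ x, ∀ m ∈ N, σ (ReducedEnveloping.incl p pm χ x) m ∈ N) (a : ReducedEnveloping p pm χ)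
    {m : M} (hm : m ∈ N) : σ a m ∈ N := by
  have ha : a ∈ Algebra.adjoin k (Set.range (ReducedEnveloping.incl p pm χ)) := by
    rw [ReducedEnveloping.adjoin_range_incl]
    trivial
  induction ha using Algebra.adjoin_induction generalizing m with
  | mem a ha =>
    obtain ⟨x, rfl⟩ := ha
    exact h x m hm
  | algebraMap c =>
    rw [AlgHom.commutes]
    exact N.smul_mem c hm
  | add a b _ _ ha hb =>
    rw [map_add]
    exact N.add_mem (ha hm) (hb hm)
  | mul a b _ _ ha hb =>
    rw [map_mul]
    exact ha (hb hm)

end Generation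

/-! ### Modules generated by a singular vector -/

section HighestWeight

variable {k : Type*} [Field k] {n p : ℕ} {M : Type*} [AddCommGroup M] [Module k M]

/-- `v` generates `M` under the action of `𝔤𝔩_n`. -/
def Generates (f : gln k n →ₗ⁅k⁆ Module.End k M) (v : M) : Prop :=
  ∀ N : Submodule k M, v ∈ N → (∀ x, ∀ w ∈ N, f x w ∈ N) → N = ⊤

theorem regularNilpotent_eq_zero {x : gln k n} (h : ∀ i j : Fin n, (i : ℕ) = j + 1 → x i j = 0) :
    regularNilpotent k n x = 0 := by
  change (∑ i : Fin n, ∑ j : Fin n, if (i : ℕ) = (j : ℕ) + 1 then x i j else 0) = 0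
  refine Finset.sum_eq_zero fun i _ => Finset.sum_eq_zero fun j _ => ?_
  split_ifs with hij
  · exact h i j hij
  · rfl

/-- Such products live at least two steps below the diagonal. This makes χ a character of 𝔫⁻. -/
theorem regularNilpotent_mul {x y : gln k n} (hx : ∀ i j, ¬ i > j → x i j = 0)
    (hy : ∀ i j, ¬ i > j → y i j = 0) : regularNilpotent k n (x * y) = 0 := by
  refine regularNilpotent_eq_zero fun i j hij => ?_
  rw [Matrix.mul_apply]
  refine Finset.sum_eq_zero fun a _ => ?_
  by_cases h : a > j
  · rw [hx i a (by rw [gt_iff_lt, Fin.lt_def] at h ⊢; omega), zero_mul]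
  · rw [hy a j h, mul_zero]

/-- The action of `x - χ(x)`, for `x` strictly lower triangular. -/
def twistedLower (f : gln k n →ₗ⁅k⁆ Module.End k M) :
    supportedSubalgebra k n (· > ·) →ₗ⁅k⁆ Module.End k M where
  toFun x := f x - algebraMap k _ (regularNilpotent k n (x : gln k n))
  map_add' x y := by
    change f ((x : gln k n) + y) - algebraMap k _ (regularNilpotent k n ((x : gln k n) + y)) = _
    rw [map_add, map_add, map_add]
    abel
  map_smul' c x := by
    change f (c • (x : gln k n)) - algebraMap k _ (regularNilpotent k n (c • (x : gln k n))) = _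
    rw [map_smul, map_smul, smul_eq_mul, map_mul, ← Algebra.smul_def, ← smul_sub]
    rfl
  map_lie' := fun {x y} => by
    have h : regularNilpotent k n ((⁅x, y⁆ : supportedSubalgebra k n (· > ·)) : gln k n) = 0 := by
      rw [LieSubalgebra.coe_bracket, LieRing.of_associative_ring_bracket, map_sub,
        regularNilpotent_mul x.2 y.2, regularNilpotent_mul y.2 x.2, sub_zero]
    change f _ - algebraMap k _ (regularNilpotent k n
      ((⁅x, y⁆ : supportedSubalgebra k n (· > ·)) : gln k n)) = _
    rw [h, map_zero, sub_zero, LieSubalgebra.coe_bracket, LieHom.map_lie,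
      LieRing.of_associative_ring_bracket, LieRing.of_associative_ring_bracket]
    have h1 := Algebra.commutes (regularNilpotent k n (x : gln k n)) (f y)
    have h2 := Algebra.commutes (regularNilpotent k n (y : gln k n)) (f x)
    have h3 := Algebra.commutes (regularNilpotent k n (x : gln k n))
      (algebraMap k (Module.End k M) (regularNilpotent k n (y : gln k n)))
    simp only [sub_mul, mul_sub, h1, h2, h3]
    abel

/-- The span of the images of all `x - χ(x)`, `x` strictly lower triangular. -/
def twistedImage (f : gln k n →ₗ⁅k⁆ Module.End k M) : Submodule k M :=
  ⨆ x, LinearMap.range (twistedLower f x)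

variable [CharP k p] {f : gln k n →ₗ⁅k⁆ Module.End k M} {l : Fin n → ZMod p} {v : M}

theorem IsSingular.borel (h : IsSingular f l v) {x : gln k n} (hx : x ∈ upperBorel k n) :
    f x v = (∑ i, ZMod.castHom (dvd_refl p) k (l i) * x i i) • v := by
  have hs : ∀ i j, f (Matrix.single i j (x i j)) v
      = if i = j then (ZMod.castHom (dvd_refl p) k (l i) * x i i) • v else 0 := by
    intro i j
    have : (Matrix.single i j (x i j) : gln k n) = x i j • Matrix.single i j 1 := by simp
    rw [this, map_smul, LinearMap.smul_apply]
    split_ifs with hij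
    · subst hij
      rw [h.diag, smul_smul, mul_comm]
    · rcases lt_or_gt_of_ne hij with hlt | hgt
      · rw [h.upper i j hlt, smul_zero]
      · rw [hx i j hgt, zero_smul]
  conv_lhs => rw [Matrix.matrix_eq_sum_single x]
  simp only [map_sum, LinearMap.sum_apply, hs, Finset.sum_ite_eq, Finset.mem_univ, if_true]
  rw [Finset.sum_smul]

/-- This is M = U(𝔫⁻)v without PBW. Let P be the least 𝔫⁻-stable subspace containing v. The vectors
w ∈ P with 𝔤w ⊆ P again form an 𝔫⁻-stable subspace containing v, so P is 𝔤-stable. -/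
theorem IsSingular.eq_top_of_lower_stable (h : IsSingular f l v) (hgen : Generates f v)
    (N : Submodule k M) (hv : v ∈ N)
    (hN : ∀ x ∈ supportedSubalgebra k n (· > ·), ∀ w ∈ N, f x w ∈ N) : N = ⊤ := by
  let P : Submodule k M := sInf {N | v ∈ N ∧
    ∀ x ∈ supportedSubalgebra k n (· > ·), ∀ w ∈ N, f x w ∈ N}
  have hvP : v ∈ P := Submodule.mem_sInf.mpr fun N hN => hN.1
  have hP : ∀ x ∈ supportedSubalgebra k n (· > ·), ∀ w ∈ P, f x w ∈ P := fun x hx w hw =>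
    Submodule.mem_sInf.mpr fun N hN => hN.2 x hx w (Submodule.mem_sInf.mp hw N hN)
  let P₀ : Submodule k M :=
    { carrier := {w | w ∈ P ∧ ∀ x, f x w ∈ P}
      add_mem' := fun {w w'} hw hw' => ⟨P.add_mem hw.1 hw'.1, fun x => by
        rw [map_add]; exact P.add_mem (hw.2 x) (hw'.2 x)⟩
      zero_mem' := ⟨P.zero_mem, fun x => by rw [map_zero]; exact P.zero_mem⟩
      smul_mem' := fun c w hw => ⟨P.smul_mem c hw.1, fun x => by
        rw [map_smul]; exact P.smul_mem c (hw.2 x)⟩ }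
  have hP₀ : P ≤ P₀ := by
    refine sInf_le ⟨⟨hvP, fun x => ?_⟩, fun y hy w hw => ⟨hP y hy w hw.1, fun x => ?_⟩⟩
    · let xl : gln k n := Matrix.of fun i j => if i > j then x i j else 0
      let xu : gln k n := Matrix.of fun i j => if i > j then 0 else x i j
      have hx : x = xl + xu := by
        ext i j
        simp only [xl, xu, Matrix.add_apply, Matrix.of_apply]
        split_ifs <;> simp
      rw [hx, map_add, LinearMap.add_apply]
      refine P.add_mem (hP xl (fun i j hij => by simp [xl, hij]) v hvP) ?_
      rw [h.borel (x := xu) fun i j hij => by simp [xu, hij]]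
      exact P.smul_mem _ hvP
    · have h1 := LinearMap.congr_fun (f.map_lie x y) w
      rw [LieRing.of_associative_ring_bracket (f x), LinearMap.sub_apply, Module.End.mul_apply,
        Module.End.mul_apply, eq_sub_iff_add_eq] at h1
      rw [← h1]
      exact P.add_mem (hw.2 _) (hP y hy _ (hw.2 x))
  have hPt : P = ⊤ := hgen P hvP fun x w hw => (hP₀ hw).2 x
  exact top_le_iff.mp (hPt ▸ sInf_le ⟨hv, hN⟩)

/-- Modulo the twisted image each x ∈ 𝔫⁻ acts by the scalar χ(x), so the left side is 𝔫⁻-stable. -/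
theorem IsSingular.span_sup_twistedImage (h : IsSingular f l v) (hgen : Generates f v) :
    Submodule.span k {v} ⊔ twistedImage f = ⊤ := by
  refine h.eq_top_of_lower_stable hgen _
    (Submodule.mem_sup_left (Submodule.mem_span_singleton_self v)) fun x hx w hw => ?_
  have h1 : f x w = regularNilpotent k n x • w + twistedLower f ⟨x, hx⟩ w := by
    change _ = _ + (f x w - regularNilpotent k n x • w)
    abel
  rw [h1]
  exact Submodule.add_mem _ (Submodule.smul_mem _ _ hw) (Submodule.mem_sup_right
    (Submodule.mem_iSup_of_mem (p := fun y => LinearMap.range (twistedLower f y)) ⟨x, hx⟩ ⟨w, rfl⟩))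

variable [Fact p.Prime]

/-- If v lies in the twisted image, that image is all of M; but the twisted action is by nilpotent
operators, and Engel's theorem applies. -/
theorem IsSingular.subsingleton_of_mem_twistedImage
    {σ : GLReduced p (regularNilpotent k n) →ₐ[k] Module.End k M}
    (h : IsSingular (actHom σ) l v) (hgen : Generates (actHom σ) v)
    (hv : v ∈ twistedImage (actHom σ)) : Subsingleton M := by
  refine subsingleton_of_iSup_range_eq_top (twistedLower (actHom σ)) (fun x => ?_) ?_
  · refine isNilpotent_actHom_sub σ x.1 (fun m hm => ?_) (pow_eq_zero_of_strictLower x.2)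
    refine regularNilpotent_eq_zero fun i j hij => ?_
    obtain ⟨q, rfl⟩ : ∃ q, m = q + 1 := ⟨m - 1, by omega⟩
    exact pow_apply_eq_zero_of_strictLower x.2 q i j (by omega)
  · have := h.span_sup_twistedImage hgen
    rwa [sup_eq_right.mpr ((Submodule.span_singleton_le_iff_mem _ _).mpr hv)] at this

end HighestWeight

/-! ### Actions on modules over the reduced enveloping algebra -/

section Modules

variable {k : Type*} [Field k] {n p : ℕ}

section

variable {χ : Module.Dual k (gln k n)} {M N : Type*} [AddCommGroup M] [Module k M]
  [Module (GLReduced p χ) M] [IsScalarTower k (GLReduced p χ) M] [AddCommGroup N] [Module k N]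
  [Module (GLReduced p χ) N] [IsScalarTower k (GLReduced p χ) N]

variable (p χ M) in
/-- The action of `𝔤𝔩_n` on a `U_χ(𝔤𝔩_n)`-module. -/
def modAct : gln k n →ₗ⁅k⁆ Module.End k M :=
  actHom (Algebra.lsmul k k M : GLReduced p χ →ₐ[k] Module.End k M)

theorem modAct_apply (x : gln k n) (m : M) :
    modAct p χ M x m = ReducedEnveloping.incl p (glPow p) χ x • m := rfl

theorem generates_of_span_eq_top {v : M} (h : Submodule.span (GLReduced p χ) {v} = ⊤) :
    Generates (modAct p χ M) v := by
  refine fun P hv hP => eq_top_iff.mpr fun m _ => ?_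
  have hm : m ∈ Submodule.span (GLReduced p χ) {v} := by rw [h]; trivial
  obtain ⟨a, rfl⟩ := Submodule.mem_span_singleton.mp hm
  exact ReducedEnveloping.apply_mem (Algebra.lsmul k k M) P hP a hv

variable [CharP k p]

theorem IsSingular.map (φ : M →ₗ[GLReduced p χ] N) {l : Fin n → ZMod p} {v : M}
    (h : IsSingular (modAct p χ M) l v) : IsSingular (modAct p χ N) l (φ v) where
  upper i j hij := by
    have := h.upper i j hij
    rw [modAct_apply] at this ⊢
    rw [← map_smul, this, map_zero]
  diag i := by
    have := h.diag i
    rw [modAct_apply] at this ⊢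
    rw [← map_smul, this, ← algebraMap_smul (GLReduced p χ), map_smul, algebraMap_smul]

end

variable [Fact p.Prime] [CharP k p]

/-! ### Baby Verma modules and their universal property -/

section BabyVerma

variable (χ : Module.Dual k (gln k n)) (hχ : ∀ x ∈ upperBorel k n, χ x = 0) (l : Fin n → ZMod p)

/-- The canonical generator `1 ⊗ 1` of a baby Verma module. -/
def babyVermaGen : BabyVerma p χ hχ l :=
  (inducedRelations (borelToGL p χ) (borelWeightRep p χ hχ l)).mkQ (1 ⊗ₜ[k] (1 : k))

theorem span_babyVermaGen : Submodule.span (GLReduced p χ) {babyVermaGen χ hχ l} = ⊤ := by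
  refine (Submodule.eq_top_iff').mpr fun z => ?_
  obtain ⟨t, rfl⟩ := Submodule.mkQ_surjective _ z
  induction t using TensorProduct.induction_on with
  | zero => rw [map_zero]; exact Submodule.zero_mem _
  | add s t hs ht => rw [map_add]; exact Submodule.add_mem _ hs ht
  | tmul a c =>
    refine Submodule.mem_span_singleton.mpr ⟨c • a, ?_⟩
    rw [babyVermaGen, ← map_smul, TensorProduct.smul_tmul', smul_eq_mul, mul_one,
      TensorProduct.smul_tmul, smul_eq_mul, mul_one]

theorem isSingular_babyVermaGen :
    IsSingular (modAct p χ (BabyVerma p χ hχ l)) l (babyVermaGen χ hχ l) := by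
  have key : ∀ x (hx : x ∈ upperBorel k n), modAct p χ (BabyVerma p χ hχ l) x (babyVermaGen χ hχ l)
      = (∑ i, ZMod.castHom (dvd_refl p) k (l i) * x i i) • babyVermaGen χ hχ l := by
    intro x hx
    rw [modAct_apply, babyVermaGen, ← map_smul, TensorProduct.smul_tmul', smul_eq_mul, mul_one]
    have h1 : (ReducedEnveloping.incl p (glPow p) χ x) ⊗ₜ[k] (1 : k)
        - 1 ⊗ₜ[k] (∑ i, ZMod.castHom (dvd_refl p) k (l i) * x i i)
        ∈ inducedRelations (borelToGL p χ) (borelWeightRep p χ hχ l) := by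
      refine Submodule.subset_span ⟨1, ReducedEnveloping.incl p (upperBorelPow p)
        (restrictBorel χ) ⟨x, hx⟩, 1, ?_⟩
      rw [borelToGL_incl, borelWeightRep_incl, one_mul, mul_one]
      rfl
    have h2 := (Submodule.Quotient.mk_eq_zero _).mpr h1
    rw [Submodule.Quotient.mk_sub, sub_eq_zero] at h2
    refine h2.trans ?_
    have h3 : (1 : GLReduced p χ) ⊗ₜ[k] (∑ i, ZMod.castHom (dvd_refl p) k (l i) * x i i)
        = (∑ i, ZMod.castHom (dvd_refl p) k (l i) * x i i) • (1 ⊗ₜ[k] (1 : k)) := by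
      rw [← TensorProduct.tmul_smul, smul_eq_mul, mul_one]
    rw [h3]
    rfl
  refine ⟨fun i j hij => ?_, fun i => ?_⟩
  · rw [key]
    · have : ∀ a, (Matrix.single i j (1 : k)) a a = 0 := fun a => by
        rw [Matrix.single_apply, if_neg]
        rintro ⟨rfl, rfl⟩
        exact lt_irrefl _ hij
      simp [this]
    · intro a b hab
      rw [Matrix.single_apply, if_neg]
      rintro ⟨rfl, rfl⟩
      exact lt_asymm hij hab
  · rw [key]
    · congr 1
      rw [Finset.sum_eq_single i]
      · simp
      · intro a _ ha
        simp [ha.symm]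
      · simp
    · intro a b hab
      rw [Matrix.single_apply, if_neg]
      rintro ⟨rfl, rfl⟩
      exact lt_irrefl _ hab

variable {χ hχ l} {M : Type*} [AddCommGroup M] [Module k M] [Module (GLReduced p χ) M]
  [IsScalarTower k (GLReduced p χ) M]

theorem exists_babyVerma_hom {v : M} (hv : IsSingular (modAct p χ M) l v) :
    ∃ φ : BabyVerma p χ hχ l →ₗ[GLReduced p χ] M, φ (babyVermaGen χ hχ l) = v := by
  let ψ : GLReduced p χ ⊗[k] k →ₗ[GLReduced p χ] M :=
    TensorProduct.AlgebraTensorModule.lift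
      { toFun := fun a => LinearMap.toSpanSingleton k M (a • v)
        map_add' := fun a b => by ext; simp [add_smul]
        map_smul' := fun a b => by ext; simp [mul_smul] }
  have hψ : ∀ a c, ψ (a ⊗ₜ[k] c) = c • a • v := fun a c => rfl
  -- U_χ(𝔟) acts on the line kv through the weight; it suffices to check this on algebra generators.
  -- This is what makes `ψ` kill the relations.
  have hb : ∀ (b : BorelReduced p χ) (c : k),
      borelToGL p χ b • (c • v) = borelWeightRep p χ hχ l b c • v := by
    intro b
    have hmem : b ∈ Algebra.adjoin k (Set.range
        (ReducedEnveloping.incl p (upperBorelPow p) (restrictBorel χ))) := by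
      rw [ReducedEnveloping.adjoin_range_incl]
      trivial
    induction hmem using Algebra.adjoin_induction with
    | mem b hb =>
      obtain ⟨x, rfl⟩ := hb
      intro c
      rw [borelToGL_incl, borelWeightRep_incl, smul_comm, ← modAct_apply, hv.borel x.2, smul_smul,
        mul_comm]
      rfl
    | algebraMap r =>
      intro c
      rw [AlgHom.commutes, AlgHom.commutes, algebraMap_smul, smul_smul]
      rfl
    | add a b _ _ ha hb =>
      intro c
      rw [map_add, add_smul, ha, hb, map_add, LinearMap.add_apply, add_smul]
    | mul a b _ _ ha hb =>
      intro c
      rw [map_mul, mul_smul, hb, ha, map_mul, Module.End.mul_apply]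
  refine ⟨(inducedRelations (borelToGL p χ) (borelWeightRep p χ hχ l)).liftQ ψ ?_, ?_⟩
  · refine Submodule.span_le.mpr ?_
    rintro _ ⟨a, b, c, rfl⟩
    rw [SetLike.mem_coe, LinearMap.mem_ker, map_sub, hψ, hψ, sub_eq_zero, mul_smul,
      smul_comm c, smul_comm c, hb, smul_comm]
  · change ψ (1 ⊗ₜ[k] 1) = v
    rw [hψ, one_smul, one_smul]

end BabyVerma

/-! ### The sum of the proper submodules -/

section Head

theorem sumOfProperSubmodules_ne_top {M : Type*} [AddCommGroup M] [Module k M]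
    [Module (GLReduced p (regularNilpotent k n)) M]
    [IsScalarTower k (GLReduced p (regularNilpotent k n)) M] [Nontrivial M] {l : Fin n → ZMod p}
    {v : M} (h : IsSingular (modAct p (regularNilpotent k n) M) l v)
    (hspan : Submodule.span (GLReduced p (regularNilpotent k n)) {v} = ⊤) :
    sumOfProperSubmodules (GLReduced p (regularNilpotent k n)) M ≠ ⊤ := by
  -- If a proper N contained cv + j with c ≠ 0 and j in the twisted image, then in M/N the generator
  -- would lie in the twisted image, and M/N would vanish.
  have hproper : ∀ N : Submodule (GLReduced p (regularNilpotent k n)) M, N ≠ ⊤ → ∀ q ∈ N,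
      q ∈ twistedImage (modAct p (regularNilpotent k n) M) := by
    intro N hN q hq
    have hq' : q ∈ Submodule.span k {v} ⊔ twistedImage (modAct p (regularNilpotent k n) M) := by
      rw [h.span_sup_twistedImage (generates_of_span_eq_top hspan)]
      trivial
    obtain ⟨y, hy, j, hj, rfl⟩ := Submodule.mem_sup.mp hq'
    obtain ⟨c, rfl⟩ := Submodule.mem_span_singleton.mp hy
    by_cases hc : c = 0
    · rwa [hc, zero_smul, zero_add]
    exfalso
    have hj' : N.mkQ j ∈ twistedImage (modAct p (regularNilpotent k n) (M ⧸ N)) := by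
      unfold twistedImage at hj
      refine Submodule.iSup_induction (p := fun y => LinearMap.range
        (twistedLower (modAct p (regularNilpotent k n) M) y))
        (motive := fun j => N.mkQ j ∈ twistedImage (modAct p (regularNilpotent k n) (M ⧸ N)))
        hj ?_ ?_ ?_
      · rintro x _ ⟨w, rfl⟩
        exact Submodule.mem_iSup_of_mem (p := fun y => LinearMap.range
          (twistedLower (modAct p (regularNilpotent k n) (M ⧸ N)) y)) x ⟨N.mkQ w, rfl⟩
      · rw [map_zero]; exact Submodule.zero_mem _
      · intro x y hx hy
        rw [map_add]; exact Submodule.add_mem _ hx hy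
    have hv' : N.mkQ v ∈ twistedImage (modAct p (regularNilpotent k n) (M ⧸ N)) := by
      have h1 : N.mkQ (c • v + j) = 0 := (Submodule.Quotient.mk_eq_zero N).mpr hq
      have h2 : c • N.mkQ v = - N.mkQ j := by
        rw [map_add] at h1
        exact eq_neg_of_add_eq_zero_left h1
      rw [← inv_smul_smul₀ hc (N.mkQ v), h2]
      exact Submodule.smul_mem _ _ (Submodule.neg_mem _ hj')
    have hspan' : Submodule.span (GLReduced p (regularNilpotent k n)) {N.mkQ v} = ⊤ := by
      rw [← Set.image_singleton, ← Submodule.map_span, hspan, Submodule.map_top,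
        Submodule.range_mkQ]
    have := (h.map N.mkQ).subsingleton_of_mem_twistedImage (generates_of_span_eq_top hspan') hv'
    exact hN ((Submodule.Quotient.subsingleton_iff).mp this)
  intro htop
  have hv : v ∈ sumOfProperSubmodules (GLReduced p (regularNilpotent k n)) M := by
    rw [htop]; trivial
  rw [sumOfProperSubmodules, sSup_eq_iSup'] at hv
  have hv' : v ∈ twistedImage (modAct p (regularNilpotent k n) M) := by
    refine Submodule.iSup_induction _ (motive := fun v => v ∈ twistedImage
      (modAct p (regularNilpotent k n) M)) hv ?_ (Submodule.zero_mem _)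
      fun x y => Submodule.add_mem _
    exact fun N q hq => hproper N N.2 q hq
  exact not_subsingleton M
    (h.subsingleton_of_mem_twistedImage (generates_of_span_eq_top hspan) hv')

end Head

end Modules

/-! ### Gelfand invariants -/

section Gelfand

variable {k : Type*} [Field k] {n : ℕ} {M : Type*} [AddCommGroup M] [Module k M]

/-- The matrix of the operators by which the matrix units act. -/
def gelfandMatrix (f : gln k n →ₗ⁅k⁆ Module.End k M) : Matrix (Fin n) (Fin n) (Module.End k M) :=
  Matrix.of fun i j => f (Matrix.single i j 1)

theorem gelfandMatrix_apply (f : gln k n →ₗ⁅k⁆ Module.End k M) (i j : Fin n) :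
    gelfandMatrix f i j = f (Matrix.single i j 1) := rfl

/-- The entries of E^m transform under 𝔤 as matrix units do; hence the traces commute with 𝔤. -/
theorem gelfandMatrix_pow_commutator (f : gln k n →ₗ⁅k⁆ Module.End k M) (m : ℕ)
    (i j a b : Fin n) :
    f (Matrix.single i j 1) * (gelfandMatrix f ^ m) a b
      = (gelfandMatrix f ^ m) a b * f (Matrix.single i j 1)
        + ((if j = a then (gelfandMatrix f ^ m) i b else 0)
          - if b = i then (gelfandMatrix f ^ m) a j else 0) := by
  induction m generalizing a b with
  | zero =>
    simp only [pow_zero, Matrix.one_apply]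
    by_cases h1 : j = a <;> by_cases h2 : b = i <;> by_cases h3 : a = b <;> subst_vars <;>
      simp_all [eq_comm]
  | succ m ih =>
    have h1 : ∀ a b, (gelfandMatrix f ^ (m + 1)) a b
        = ∑ c, (gelfandMatrix f ^ m) a c * f (Matrix.single c b 1) := fun a b => by
      rw [pow_succ, Matrix.mul_apply]
      rfl
    have hE : ∀ c, f (Matrix.single i j 1) * f (Matrix.single c b 1)
        = f (Matrix.single c b 1) * f (Matrix.single i j 1)
          + ((if j = c then f (Matrix.single i b 1) else 0)
            - if b = i then f (Matrix.single c j 1) else 0) := fun c => by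
      refine LinearMap.ext fun v => ?_
      have := f.map_single_mul_single i j c b v
      rw [Module.End.mul_apply, this]
      simp only [LinearMap.add_apply, LinearMap.sub_apply, Module.End.mul_apply]
      split_ifs <;> rfl
    have h2 : ∀ c, f (Matrix.single i j 1)
          * ((gelfandMatrix f ^ m) a c * f (Matrix.single c b 1))
        = (gelfandMatrix f ^ m) a c * f (Matrix.single c b 1) * f (Matrix.single i j 1)
          + ((gelfandMatrix f ^ m) a c * (if j = c then f (Matrix.single i b 1) else 0)
            - (gelfandMatrix f ^ m) a c * (if b = i then f (Matrix.single c j 1) else 0))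
          + ((if j = a then (gelfandMatrix f ^ m) i c else 0) * f (Matrix.single c b 1)
            - (if c = i then (gelfandMatrix f ^ m) a j else 0) * f (Matrix.single c b 1)) := by
      intro c
      rw [← mul_assoc, ih, add_mul, mul_assoc, hE]
      noncomm_ring
    simp only [h1, Finset.mul_sum, h2, Finset.sum_add_distrib, Finset.sum_sub_distrib,
      Finset.sum_mul]
    simp only [mul_ite, ite_mul, mul_zero, zero_mul, Finset.sum_ite_eq, Finset.sum_ite_eq',
      Finset.mem_univ, if_true]
    have h3 : ∀ (P : Prop) [Decidable P] (g : Fin n → Module.End k M),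
        ∑ c, (if P then g c else 0) = if P then ∑ c, g c else 0 := by
      intro P _ g
      split_ifs <;> simp
    rw [h3, h3]
    abel

/-- The trace of a power of the matrix of operators. -/
def gelfandTrace (f : gln k n →ₗ⁅k⁆ Module.End k M) (m : ℕ) : Module.End k M :=
  ∑ a, (gelfandMatrix f ^ m) a a

theorem gelfandTrace_commute (f : gln k n →ₗ⁅k⁆ Module.End k M) (m : ℕ) (x : gln k n) :
    f x * gelfandTrace f m = gelfandTrace f m * f x := by
  have hs : ∀ i j, f (Matrix.single i j 1) * gelfandTrace f m
      = gelfandTrace f m * f (Matrix.single i j 1) := fun i j => by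
    simp only [gelfandTrace, Finset.mul_sum, gelfandMatrix_pow_commutator, Finset.sum_add_distrib,
      Finset.sum_sub_distrib, Finset.sum_ite_eq, Finset.sum_ite_eq', Finset.mem_univ, if_true,
      sub_self, add_zero, Finset.sum_mul]
  rw [Matrix.matrix_eq_sum_single x]
  simp only [map_sum, Finset.sum_mul, Finset.mul_sum]
  refine Finset.sum_congr rfl fun i _ => Finset.sum_congr rfl fun j _ => ?_
  have : (Matrix.single i j (x i j) : gln k n) = x i j • Matrix.single i j 1 := by simp
  rw [this, map_smul, smul_mul_assoc, hs, mul_smul_comm]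

variable {p : ℕ}

/-- The matrix `A` such that `tr (E ^ m)` acts on singular vectors of weight `l` by the sum of the
entries of `A ^ m`. -/
def gelfandScalarMatrix (l : Fin n → ZMod p) : Matrix (Fin n) (Fin n) (ZMod p) :=
  Matrix.of fun i j => if i = j then l i + weylRho i else if i < j then -1 else 0

/-- The sum of the entries of `A ^ m`. -/
def sumEntriesPow {ι R : Type*} [Fintype ι] [DecidableEq ι] [CommRing R] (A : Matrix ι ι R)
    (m : ℕ) : R :=
  ∑ i, (A ^ m).mulVec 1 i

theorem card_filter_lt_eq_weylRho (i : Fin n) :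
    ((Finset.univ.filter fun j => i < j).card : ZMod p) = weylRho i := by
  have : (Finset.univ.filter fun j => i < j) = Finset.Ioi i := by ext j; simp
  rw [this, Fin.card_Ioi]
  unfold weylRho
  have := i.isLt
  rw [Nat.sub_sub, Nat.cast_sub (by omega)]
  push_cast
  ring

/-- The right side is the recursion met in `gelfandMatrix_pow_diag`. The number of a > i is ρ_i
modulo p, whence the diagonal l + ρ. -/
theorem gelfandScalarMatrix_mulVec (l c : Fin n → ZMod p) (i : Fin n) :
    (gelfandScalarMatrix l).mulVec c i
      = l i * c i + ∑ a, if i < a then c i - c a else 0 := by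
  have h1 : ∀ a, gelfandScalarMatrix l i a * c a
      = (if i = a then (l i + weylRho i) * c i else 0) - if i < a then c a else 0 := by
    intro a
    simp only [gelfandScalarMatrix, Matrix.of_apply]
    by_cases h : i = a
    · subst h; simp
    · by_cases h' : i < a <;> simp [h, h']
  have h2 : ∀ a, (if i < a then c i - c a else 0)
      = (if i < a then c i else 0) - if i < a then c a else 0 := by
    intro a; split_ifs <;> simp
  simp only [Matrix.mulVec, dotProduct, h1, h2, Finset.sum_sub_distrib, Finset.sum_ite_eq,
    Finset.mem_univ, if_true]
  have h3 : ∑ x, (if i < x then c i else 0) = weylRho i * c i := by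
    rw [← Finset.sum_filter, Finset.sum_const, nsmul_eq_mul, card_filter_lt_eq_weylRho]
  rw [h3]
  ring

variable [CharP k p] {f : gln k n →ₗ⁅k⁆ Module.End k M} {l : Fin n → ZMod p} {v : M}

theorem IsSingular.gelfandMatrix_pow_upper (h : IsSingular f l v) (m : ℕ) {i b : Fin n}
    (hib : i < b) : (gelfandMatrix f ^ m) i b v = 0 := by
  induction m generalizing i b with
  | zero => rw [pow_zero, Matrix.one_apply_ne hib.ne, LinearMap.zero_apply]
  | succ m ih =>
    rw [pow_succ, Matrix.mul_apply, LinearMap.sum_apply]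
    refine Finset.sum_eq_zero fun a _ => ?_
    rw [Module.End.mul_apply, gelfandMatrix_apply]
    rcases lt_trichotomy a b with hab | rfl | hab
    · rw [h.upper a b hab, map_zero]
    · rw [h.diag, map_smul, ih hib, smul_zero]
    · have h1 := LinearMap.congr_fun (gelfandMatrix_pow_commutator f m a b i a) v
      rw [if_neg hib.ne', if_pos rfl] at h1
      simp only [LinearMap.add_apply, LinearMap.sub_apply, Module.End.mul_apply,
        LinearMap.zero_apply] at h1
      rw [ih (hib.trans hab), ih hib, map_zero] at h1
      simpa using h1.symm

theorem IsSingular.gelfandMatrix_pow_diag (h : IsSingular f l v) (m : ℕ) (i : Fin n) :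
    (gelfandMatrix f ^ m) i i v
      = ZMod.castHom (dvd_refl p) k ((gelfandScalarMatrix l ^ m).mulVec 1 i) • v := by
  induction m generalizing i with
  | zero => simp
  | succ m ih =>
    rw [pow_succ' (gelfandScalarMatrix l), ← Matrix.mulVec_mulVec, gelfandScalarMatrix_mulVec,
      pow_succ, Matrix.mul_apply, LinearMap.sum_apply]
    set c := (gelfandScalarMatrix l ^ m).mulVec 1
    have hterm : ∀ a, ((gelfandMatrix f ^ m) i a * gelfandMatrix f a i) v
        = (if a = i then ZMod.castHom (dvd_refl p) k (l i * c i) • v else 0)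
          + ZMod.castHom (dvd_refl p) k (if i < a then c i - c a else 0) • v := by
      intro a
      rw [Module.End.mul_apply, gelfandMatrix_apply]
      rcases lt_trichotomy a i with hai | rfl | hai
      · rw [h.upper a i hai, map_zero, if_neg hai.ne, if_neg (lt_asymm hai)]
        simp
      · rw [h.diag, map_smul, ih, if_pos rfl, if_neg (lt_irrefl a), smul_smul, ← map_mul]
        simp
      -- For a > i the lowering unit E_ai is moved to the left of (E^m)_ia, which kills v. What
      -- remains is (E^m)_ii − (E^m)_aa.
      · have h1 := LinearMap.congr_fun (gelfandMatrix_pow_commutator f m a i i a) v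
        rw [if_pos rfl, if_pos rfl] at h1
        simp only [LinearMap.add_apply, LinearMap.sub_apply, Module.End.mul_apply] at h1
        rw [h.gelfandMatrix_pow_upper m hai, map_zero, ih, ih] at h1
        rw [if_neg hai.ne', if_pos hai, zero_add, map_sub, sub_smul]
        rw [eq_comm, add_eq_zero_iff_eq_neg, neg_sub] at h1
        exact h1
    simp only [hterm, Finset.sum_add_distrib, Finset.sum_ite_eq', Finset.mem_univ, if_true]
    rw [← Finset.sum_smul, ← map_sum, ← add_smul, ← map_add]

theorem IsSingular.gelfandTrace_apply (h : IsSingular f l v) (m : ℕ) :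
    gelfandTrace f m v
      = ZMod.castHom (dvd_refl p) k (sumEntriesPow (gelfandScalarMatrix l) m) • v := by
  simp only [gelfandTrace, LinearMap.sum_apply, h.gelfandMatrix_pow_diag, sumEntriesPow, map_sum,
    Finset.sum_smul]

/-- An operator commuting with 𝔤 is scalar on a cyclic module generated by an eigenvector of it, so
its scalar can be read off at either singular vector. -/
theorem IsSingular.sumEntriesPow_eq [Fact p.Prime] (h : IsSingular f l v) (hgen : Generates f v)
    {l' : Fin n → ZMod p} {v' : M} (h' : IsSingular f l' v') (hv' : v' ≠ 0) (m : ℕ) :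
    sumEntriesPow (gelfandScalarMatrix l) m = sumEntriesPow (gelfandScalarMatrix l') m := by
  set c := ZMod.castHom (dvd_refl p) k (sumEntriesPow (gelfandScalarMatrix l) m) with hc
  have hN : LinearMap.eqLocus (gelfandTrace f m) (algebraMap k (Module.End k M) c) = ⊤ := by
    refine hgen _ (h.gelfandTrace_apply m) fun x w hw => ?_
    have hw' : gelfandTrace f m w = c • w := hw
    have h1 := LinearMap.congr_fun (gelfandTrace_commute f m x) w
    rw [Module.End.mul_apply, Module.End.mul_apply, hw', map_smul] at h1
    exact h1.symm
  have h1 : gelfandTrace f m v' = c • v' := by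
    have : v' ∈ LinearMap.eqLocus (gelfandTrace f m) (algebraMap k (Module.End k M) c) := by
      rw [hN]; trivial
    exact this
  rw [h'.gelfandTrace_apply m] at h1
  exact ((ZMod.castHom (dvd_refl p) k).injective (smul_left_injective k hv' h1)).symm

end Gelfand

/-! ### Weights with equal invariants -/

section Determinant

open Polynomial in
-- Matrix determinant lemma for the rank-one perturbation by 𝟙𝟙ᵀ: the factor is 1 − X·𝟙ᵀ(1 − XA)⁻¹𝟙,
-- and the geometric series expands it into sums of entries of the A^m.
theorem charpolyRev_add_one {ι R : Type*} [Fintype ι] [DecidableEq ι] [CommRing R]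
    (A : Matrix ι ι R) :
    ((A + Matrix.of fun _ _ => 1).charpolyRev : PowerSeries R)
      = (A.charpolyRev : PowerSeries R)
        * (1 - PowerSeries.X * PowerSeries.mk (sumEntriesPow A)) := by
  have hdet : ∀ B : Matrix ι ι R, (B.charpolyRev : PowerSeries R)
      = (1 - (PowerSeries.X : PowerSeries R) • B.map PowerSeries.C).det := by
    intro B
    refine (RingHom.map_det (Polynomial.coeToPowerSeries.ringHom (R := R))
      (1 - (X : R[X]) • B.map C)).trans ?_
    congr 1
    ext1 i j
    simp only [RingHom.mapMatrix_apply, Matrix.map_apply, Matrix.sub_apply, Matrix.smul_apply,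
      smul_eq_mul, map_sub, map_mul, Polynomial.coeToPowerSeries.ringHom_apply, Polynomial.coe_X,
      Polynomial.coe_C, Matrix.one_apply]
    split_ifs <;> simp
  -- The geometric series, inverse to 1 − XA.
  let S : Matrix ι ι (PowerSeries R) := Matrix.of fun i j => PowerSeries.mk fun m => (A ^ m) i j
  have hS : (1 - (PowerSeries.X : PowerSeries R) • A.map PowerSeries.C) * S = 1 := by
    ext i j m
    rw [sub_mul, one_mul, Matrix.smul_mul, Matrix.sub_apply, Matrix.smul_apply, Matrix.mul_apply,
      map_sub, smul_eq_mul]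
    cases m with
    | zero => simp [S, Matrix.one_apply]
    | succ m =>
      rw [mul_comm, PowerSeries.coeff_succ_mul_X, map_sum]
      simp only [S, Matrix.of_apply, Matrix.map_apply, PowerSeries.coeff_C_mul,
        PowerSeries.coeff_mk]
      rw [pow_succ', Matrix.mul_apply, sub_self, Matrix.one_apply]
      split_ifs <;> simp [PowerSeries.coeff_one]
  let u : ι → PowerSeries R := -((PowerSeries.X : PowerSeries R) • S.mulVec 1)
  let U : Matrix ι Unit (PowerSeries R) := Matrix.replicateCol Unit u
  let V : Matrix Unit ι (PowerSeries R) := Matrix.replicateRow Unit 1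
  let T : Matrix ι Unit (PowerSeries R) := Matrix.replicateCol Unit 1
  have hUV : (1 + U * V).det = 1 + (1 : ι → PowerSeries R) ⬝ᵥ u :=
    Matrix.det_one_add_replicateCol_mul_replicateRow u 1
  have hfac : (1 - (PowerSeries.X : PowerSeries R)
        • (A + Matrix.of fun _ _ => 1 : Matrix ι ι R).map PowerSeries.C)
      = (1 - (PowerSeries.X : PowerSeries R) • A.map PowerSeries.C)
        * (1 + U * V) := by
    have h1 : U = -((PowerSeries.X : PowerSeries R) • (S * T)) := by
      ext1 i j
      simp [U, T, u, Matrix.mul_apply, Matrix.mulVec, dotProduct]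
    rw [h1, mul_add, mul_one, Matrix.neg_mul, Matrix.mul_neg, Matrix.smul_mul, Matrix.mul_smul,
      ← Matrix.mul_assoc, ← Matrix.mul_assoc, hS, Matrix.one_mul, ← sub_eq_add_neg, sub_sub,
      ← smul_add]
    congr 2
    ext1 i j
    simp [V, T, Matrix.mul_apply]
  rw [hdet, hfac, Matrix.det_mul, ← hdet, hUV]
  congr 1
  rw [sub_eq_add_neg]
  congr 1
  simp only [u, dotProduct, Pi.one_apply, one_mul, Pi.neg_apply, Pi.smul_apply, smul_eq_mul,
    Finset.sum_neg_distrib, ← Finset.mul_sum]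
  congr 2
  ext m
  simp [S, sumEntriesPow, Matrix.mulVec, dotProduct]

open Polynomial in
theorem eq_of_reverse_eq {R : Type*} [Semiring R] {P Q : R[X]} (hd : P.natDegree = Q.natDegree)
    (h : P.reverse = Q.reverse) : P = Q := by
  ext m
  have := congrArg (fun F => F.coeff (revAt P.natDegree m)) h
  simp only [reverse, ← hd, coeff_reflect, revAt_invol] at this
  exact this

open Polynomial in
-- The sums of entries determine the ratio of the reversed characteristic polynomials of A + 𝟙𝟙ᵀ and
-- A. Reversal loses nothing because both products have the same degree.
theorem charpoly_mul_eq_of_sumEntriesPow_eq {ι R : Type*} [Fintype ι] [DecidableEq ι] [CommRing R]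
    [IsDomain R] (A B : Matrix ι ι R) (h : ∀ m, sumEntriesPow A m = sumEntriesPow B m) :
    (A + Matrix.of fun _ _ => 1 : Matrix ι ι R).charpoly * B.charpoly
      = (B + Matrix.of fun _ _ => 1 : Matrix ι ι R).charpoly * A.charpoly := by
  apply eq_of_reverse_eq
  · rw [(Matrix.charpoly_monic _).natDegree_mul (Matrix.charpoly_monic _),
      (Matrix.charpoly_monic _).natDegree_mul (Matrix.charpoly_monic _)]
    simp only [Matrix.charpoly_natDegree_eq_dim]
  · simp only [reverse_mul_of_domain, Matrix.reverse_charpoly]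
    apply Polynomial.coe_injective
    rw [Polynomial.coe_mul, Polynomial.coe_mul, charpolyRev_add_one, charpolyRev_add_one,
      funext h]
    ring

end Determinant

/-! ### The orbit of the weight zero -/

section Orbit

variable {n p : ℕ}

open Polynomial in
theorem charpoly_gelfandScalarMatrix (l : Fin n → ZMod p) :
    (gelfandScalarMatrix l).charpoly = ∏ i, (X - C (l i + weylRho i)) := by
  rw [Matrix.charpoly_of_isUpperTriangular]
  · simp [gelfandScalarMatrix]
  · intro i j hij
    have hij' : j < i := hij
    simp [gelfandScalarMatrix, hij'.ne', lt_asymm hij']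

open Polynomial in
-- Adding 1 everywhere cancels the entries −1 above the diagonal, leaving a lower triangular matrix.
theorem charpoly_gelfandScalarMatrix_add_one (l : Fin n → ZMod p) :
    (gelfandScalarMatrix l + Matrix.of fun _ _ => 1 : Matrix (Fin n) (Fin n) (ZMod p)).charpoly
      = ∏ i, (X - C (l i + weylRho i + 1)) := by
  rw [← Matrix.charpoly_transpose, Matrix.charpoly_of_isUpperTriangular]
  · simp [gelfandScalarMatrix]
  · intro i j hij
    have hij' : j < i := hij
    simp [gelfandScalarMatrix, hij', hij'.ne]

/-- A cyclic rotation of the indices lowers ρ by 1; at the last index the wrap-around needs n = 0 in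
𝔽_p. -/
theorem exists_weylRho_comp_eq (hpn : p ∣ n) :
    ∃ τ : Equiv.Perm (Fin n), (weylRho ∘ τ : Fin n → ZMod p) = weylRho - 1 := by
  cases n with
  | zero => exact ⟨1, Subsingleton.elim _ _⟩
  | succ m =>
    refine ⟨finRotate (m + 1), funext fun i => ?_⟩
    have h0 : ((m + 1 : ℕ) : ZMod p) = 0 := (ZMod.natCast_eq_zero_iff _ _).mpr hpn
    simp only [Function.comp_apply, Pi.sub_apply, Pi.one_apply, weylRho, h0]
    rw [coe_finRotate]
    split_ifs with h
    · subst h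
      push_cast at h0
      rw [Fin.val_last, h0]
      simp
    · push_cast
      ring

/-- The number of indices at which a weight takes a given value. -/
def weightCount (x : Fin n → ZMod p) (a : ZMod p) : ℕ :=
  (Finset.univ.filter fun i => x i = a).card

theorem count_map_univ (x : Fin n → ZMod p) (a : ZMod p) :
    (Finset.univ.val.map x).count a = weightCount x a := by
  rw [Multiset.count_map, weightCount, Finset.card_def, Finset.filter_val]
  congr 1
  exact Multiset.filter_congr fun _ _ => eq_comm

theorem exists_perm_of_weightCount_eq {x y : Fin n → ZMod p} (h : weightCount x = weightCount y) :
    ∃ w : Equiv.Perm (Fin n), x = y ∘ w := by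
  have he : ∀ a, Nonempty ({i // x i = a} ≃ {i // y i = a}) := fun a => by
    refine ⟨Fintype.equivOfCardEq ?_⟩
    rw [Fintype.card_subtype, Fintype.card_subtype]
    exact congrFun h a
  exact ⟨Equiv.ofFiberEquiv fun a => (he a).some,
    funext fun i => (Equiv.ofFiberEquiv_map _ i).symm⟩

variable [Fact p.Prime]

theorem sum_weightCount (x : Fin n → ZMod p) : ∑ a, weightCount x a = n := by
  have := Finset.card_eq_sum_card_fiberwise (s := (Finset.univ : Finset (Fin n)))
    (t := (Finset.univ : Finset (ZMod p))) (f := x) fun _ _ => Finset.mem_univ _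
  rw [Finset.card_univ, Fintype.card_fin] at this
  exact this.symm

theorem eq_of_forall_add_one_eq {α : Type*} {g : ZMod p → α} (h : ∀ a, g (a + 1) = g a)
    (a : ZMod p) : g a = g 0 := by
  have : ∀ m : ℕ, g (m : ZMod p) = g 0 := by
    intro m
    induction m with
    | zero => rw [Nat.cast_zero]
    | succ m ih => rw [Nat.cast_succ, h, ih]
  rw [← this a.val, ZMod.natCast_zmod_val]

theorem weightCount_eq_of_forall_add_one_eq {x y : Fin n → ZMod p}
    (hx : ∀ a, weightCount x (a + 1) = weightCount x a)
    (hy : ∀ a, weightCount y (a + 1) = weightCount y a) : weightCount x = weightCount y := by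
  have h := (sum_weightCount x).trans (sum_weightCount y).symm
  rw [Finset.sum_congr rfl fun a _ => eq_of_forall_add_one_eq hx a,
    Finset.sum_congr rfl fun a _ => eq_of_forall_add_one_eq hy a, Finset.sum_const,
    Finset.sum_const, smul_eq_mul, smul_eq_mul] at h
  funext a
  rw [eq_of_forall_add_one_eq hx, eq_of_forall_add_one_eq hy]
  exact Nat.eq_of_mul_eq_mul_left (Finset.card_pos.mpr Finset.univ_nonempty) h

/-- The first difference is constant on ℤ/p and sums to zero around the cycle, so it vanishes as an
integer. -/
theorem weightCount_add_one_eq_of_second_difference {x : Fin n → ZMod p}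
    (h : ∀ a, 2 * weightCount x (a + 1) = weightCount x (a + 2) + weightCount x a) (a : ZMod p) :
    weightCount x (a + 1) = weightCount x a := by
  let d : ZMod p → ℤ := fun a => weightCount x (a + 1) - weightCount x a
  have hd : ∀ a, d a = d 0 := eq_of_forall_add_one_eq fun a => by
    have := h a
    have e : a + 1 + 1 = a + 2 := by ring
    simp only [d, e]
    omega
  have hs : ∑ a, d a = 0 := by
    simp only [d, Finset.sum_sub_distrib]
    rw [sub_eq_zero]
    exact Fintype.sum_equiv (Equiv.addRight 1) _ _ fun _ => rfl
  rw [Finset.sum_congr rfl fun a _ => hd a, Finset.sum_const, smul_eq_zero] at hs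
  have h0 : d 0 = 0 := hs.resolve_left (Finset.card_pos.mpr Finset.univ_nonempty).ne'
  have := hd a
  rw [h0] at this
  simp only [d] at this
  omega

open Polynomial in
theorem exists_dotAction_zero_of_sumEntriesPow_eq (hpn : p ∣ n) {l : Fin n → ZMod p}
    (h : ∀ m, sumEntriesPow (gelfandScalarMatrix l) m
      = sumEntriesPow (gelfandScalarMatrix (l + 1)) m) :
    ∃ w : Equiv.Perm (Fin n), l = dotAction w 0 := by
  have h1 := charpoly_mul_eq_of_sumEntriesPow_eq _ _ h
  simp only [charpoly_gelfandScalarMatrix, charpoly_gelfandScalarMatrix_add_one] at h1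
  have hroots : ∀ g : Fin n → ZMod p,
      (∏ i, (X - C (g i))).roots = Finset.univ.val.map g := fun g => by
    have := roots_multiset_prod_X_sub_C (Finset.univ.val.map g)
    rwa [Multiset.map_map] at this
  have hne : ∀ g : Fin n → ZMod p, (∏ i, (X - C (g i))) ≠ 0 := fun g =>
    (monic_prod_of_monic _ _ fun i _ => monic_X_sub_C (g i)).ne_zero
  have h2 := congrArg roots h1
  rw [roots_mul (mul_ne_zero (hne _) (hne _)), roots_mul (mul_ne_zero (hne _) (hne _)), hroots,
    hroots, hroots, hroots] at h2
  have hshift : ∀ (b c : ZMod p) (g : Fin n → ZMod p), (∀ i, g i = l i + weylRho i + b) →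
      weightCount g (c + b) = weightCount (l + weylRho) c := by
    intro b c g hg
    unfold weightCount
    congr 1
    ext i
    simp [hg]
  -- With c the multiplicities in l + ρ, the number a + 2 is a root c(a+1) + c(a+1) times on one
  -- side and c(a) + c(a+2) times on the other.
  have hx := weightCount_add_one_eq_of_second_difference (x := l + weylRho) (fun a => by
    have h3 := congrArg (Multiset.count (a + 2)) h2
    rw [Multiset.count_add, Multiset.count_add, count_map_univ, count_map_univ, count_map_univ,
      count_map_univ] at h3
    have e : a + 2 = a + 1 + 1 := by ring
    have h4 := hshift 1 (a + 1) (fun i => l i + weylRho i + 1) fun i => rfl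
    have h5 := hshift 1 (a + 1) (fun i => (l + 1) i + weylRho i) fun i => by
      simp only [Pi.add_apply, Pi.one_apply]; ring
    have h6 := hshift 2 a (fun i => (l + 1) i + weylRho i + 1) fun i => by
      simp only [Pi.add_apply, Pi.one_apply]; ring
    have h7 := hshift 0 (a + 2) (fun i => l i + weylRho i) fun i => (add_zero _).symm
    rw [← e] at h4 h5
    rw [add_zero] at h7
    rw [h4, h5, h6, h7] at h3
    omega)
  obtain ⟨τ, hτ⟩ := exists_weylRho_comp_eq hpn
  have hρ : ∀ a, weightCount (weylRho (n := n) : Fin n → ZMod p) (a + 1) = weightCount (weylRho (n := n)) a := by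
    intro a
    refine Finset.card_equiv τ fun i => ?_
    have := congrFun hτ i
    simp only [Function.comp_apply, Pi.sub_apply, Pi.one_apply] at this
    simp [this, sub_eq_iff_eq_add]
  obtain ⟨w, hw⟩ := exists_perm_of_weightCount_eq (weightCount_eq_of_forall_add_one_eq hx hρ)
  refine ⟨w⁻¹, funext fun i => ?_⟩
  have := congrFun hw i
  simp only [Pi.add_apply, Function.comp_apply] at this
  simp [dotAction, ← this]

end Orbit

/-! ### Simple heads and their twists -/

section Final

variable {k : Type*} [Field k] {n p : ℕ}

instance {A M : Type*} [Ring A] [Algebra k A] [AddCommGroup M] [Module k M]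
    (σ : A →ₐ[k] Module.End k M) : IsScalarTower k A (RepModule σ) where
  smul_assoc c a m := by
    change σ (c • a) m = c • σ a m
    rw [map_smul]
    rfl

theorem modAct_repModule {χ : Module.Dual k (gln k n)} {M : Type*} [AddCommGroup M] [Module k M]
    (σ : GLReduced p χ →ₐ[k] Module.End k M) (x : gln k n) (m : M) :
    modAct p χ (RepModule σ) x m = actHom σ x m := rfl

variable [Fact p.Prime] [CharP k p]

instance babyVerma_nontrivial (l : Fin n → ZMod p) :
    Nontrivial (BabyVerma p (regularNilpotent k n) (regularNilpotent_borel k n) l) := by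
  obtain ⟨M, _, _, σ, v, hv, hs⟩ := occursSingular (k := k) (l + weylRho)
  rw [add_sub_cancel_right] at hs
  have hs' : IsSingular (modAct p (regularNilpotent k n) (RepModule σ)) l v :=
    ⟨hs.upper, hs.diag⟩
  obtain ⟨φ, hφ⟩ := exists_babyVerma_hom (hχ := regularNilpotent_borel k n) hs'
  refine ⟨⟨babyVermaGen _ _ l, 0, fun h => hv ?_⟩⟩
  rw [← hφ, h, map_zero]
  rfl

theorem isCoatom_sumOfProperSubmodules (l : Fin n → ZMod p) :
    IsCoatom (sumOfProperSubmodules (GLReduced p (regularNilpotent k n))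
      (BabyVerma p (regularNilpotent k n) (regularNilpotent_borel k n) l)) := by
  refine ⟨sumOfProperSubmodules_ne_top (isSingular_babyVermaGen _ _ l) (span_babyVermaGen _ _ l),
    fun N hN => ?_⟩
  by_contra hne
  exact hN.not_ge (le_sSup hne)

instance isSimpleModule_simpleHead (l : Fin n → ZMod p) :
    IsSimpleModule (GLReduced p (regularNilpotent k n))
      (SimpleHead p (regularNilpotent k n) (regularNilpotent_borel k n) l) :=
  isSimpleModule_iff_isCoatom.mpr (isCoatom_sumOfProperSubmodules l)

/-- A simple module with a nonzero singular vector of weight `l` is isomorphic to `L_χ(l)`. -/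
theorem nonempty_simpleHead_equiv {M : Type*} [AddCommGroup M] [Module k M]
    [Module (GLReduced p (regularNilpotent k n)) M]
    [IsScalarTower k (GLReduced p (regularNilpotent k n)) M]
    [IsSimpleModule (GLReduced p (regularNilpotent k n)) M] {l : Fin n → ZMod p} {v : M}
    (hv : v ≠ 0) (h : IsSingular (modAct p (regularNilpotent k n) M) l v) :
    Nonempty (SimpleHead p (regularNilpotent k n) (regularNilpotent_borel k n) l
      ≃ₗ[GLReduced p (regularNilpotent k n)] M) := by
  obtain ⟨φ, hφ⟩ := exists_babyVerma_hom (hχ := regularNilpotent_borel k n) h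
  have hne : φ ≠ 0 := fun h0 => hv (by rw [← hφ, h0, LinearMap.zero_apply])
  have hsurj : Function.Surjective φ := LinearMap.surjective_of_ne_zero hne
  have hker : IsCoatom (LinearMap.ker φ) := by
    rw [← isSimpleModule_iff_isCoatom]
    exact IsSimpleModule.congr (φ.quotKerEquivOfSurjective hsurj)
  -- The kernel is a maximal submodule contained in the sum of the proper ones, which is itself
  -- proper.
  have heq : sumOfProperSubmodules (GLReduced p (regularNilpotent k n))
      (BabyVerma p (regularNilpotent k n) (regularNilpotent_borel k n) l) = LinearMap.ker φ :=
    ((hker.le_iff.mp (le_sSup hker.1)).resolve_left (isCoatom_sumOfProperSubmodules l).1)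
  exact ⟨(Submodule.quotEquivOfEq _ _ heq).trans (φ.quotKerEquivOfSurjective hsurj)⟩

/-! ### Twisting by a multiple of the trace -/

section Twist

variable {χ : Module.Dual k (gln k n)} {M : Type*} [AddCommGroup M] [Module k M]
  [Module (GLReduced p χ) M] [IsScalarTower k (GLReduced p χ) M] {a : ZMod p}

theorem modAct_twistByTrace (x : gln k n) (m : M) :
    modAct p χ (TwistByTrace p χ M a) x (m ⊗ₜ[k] (1 : k) : M ⊗[k] k)
      = (modAct p χ M x m + (ZMod.castHom (dvd_refl p) k a * x.trace) • m) ⊗ₜ[k] (1 : k) := by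
  rw [modAct_repModule, actHom_apply, tensorRep_incl, traceRep_incl, TensorProduct.add_tmul,
    TensorProduct.smul_tmul, smul_eq_mul]
  rfl

theorem IsSingular.twistByTrace {l : Fin n → ZMod p} {v : M}
    (h : IsSingular (modAct p χ M) l v) :
    IsSingular (modAct p χ (TwistByTrace p χ M a)) (l + fun _ => a)
      (v ⊗ₜ[k] (1 : k) : M ⊗[k] k) where
  upper i j hij := by
    rw [modAct_twistByTrace, h.upper i j hij, Matrix.trace_single_eq_of_ne _ _ _ hij.ne]
    simp
    rfl
  diag i := by
    rw [modAct_twistByTrace, h.diag i, Matrix.trace_single_eq_same, mul_one, ← add_smul, ← map_add]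
    rfl

theorem tmul_one_ne_zero {m : M} (hm : m ≠ 0) : (m ⊗ₜ[k] (1 : k) : M ⊗[k] k) ≠ 0 := by
  intro h
  have := congrArg (TensorProduct.rid k M) h
  rw [TensorProduct.rid_tmul, one_smul, map_zero] at this
  exact hm this

/-- Under m ↦ m ⊗ 1 the two actions of each x differ by a scalar, so submodules correspond. -/
instance isSimpleModule_twistByTrace [IsSimpleModule (GLReduced p χ) M] :
    IsSimpleModule (GLReduced p χ) (TwistByTrace p χ M a) := by
  have hall : ∀ t : M ⊗[k] k, ∃ m : M, t = m ⊗ₜ[k] (1 : k) := fun t =>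
    ⟨TensorProduct.rid k M t, by
      rw [← TensorProduct.rid_symm_apply, LinearEquiv.symm_apply_apply]⟩
  obtain ⟨m₀, hm₀⟩ := @exists_ne M (IsSimpleModule.nontrivial (GLReduced p χ) M) 0
  refine { toIsSimpleOrder := { exists_pair_ne := ⟨⊥, ⊤, fun h => ?_⟩,
                                eq_bot_or_eq_top := fun N => ?_ } }
  · have : (m₀ ⊗ₜ[k] (1 : k) : M ⊗[k] k) ∈ (⊥ : Submodule (GLReduced p χ)
        (TwistByTrace p χ M a)) := by
      rw [h]; trivial
    exact tmul_one_ne_zero hm₀ this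
  · let ι : M →ₗ[k] TwistByTrace p χ M a := (TensorProduct.rid k M).symm.toLinearMap
    have hι : ∀ m, ι m = (m ⊗ₜ[k] (1 : k) : M ⊗[k] k) := fun m =>
      TensorProduct.rid_symm_apply m
    let P : Submodule k M := (N.restrictScalars k).comap ι
    have hP : ∀ x, ∀ m ∈ P, modAct p χ M x m ∈ P := by
      intro x m hm
      have h1 : ι (modAct p χ M x m) = modAct p χ (TwistByTrace p χ M a) x (ι m)
          - (ZMod.castHom (dvd_refl p) k a * x.trace) • ι m := by
        rw [eq_sub_iff_add_eq, ← map_smul, ← map_add, hι, hι, modAct_twistByTrace]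
      change ι _ ∈ N.restrictScalars k
      rw [h1]
      exact Submodule.sub_mem _ (N.smul_mem _ hm) (Submodule.smul_mem _ _ hm)
    let N' : Submodule (GLReduced p χ) M :=
      { P.toAddSubmonoid with
        smul_mem' := fun b m hm => ReducedEnveloping.apply_mem (Algebra.lsmul k k M) P hP b hm }
    have hN' : ∀ m, m ∈ N' ↔ ι m ∈ N := fun m => Iff.rfl
    rcases eq_bot_or_eq_top N' with h | h
    · left
      rw [eq_bot_iff]
      intro t ht
      obtain ⟨m, rfl⟩ := hall t
      have hm : m ∈ N' := (hN' m).mpr (by rw [hι]; exact ht)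
      rw [h, Submodule.mem_bot] at hm
      rw [hm, TensorProduct.zero_tmul]
      exact Submodule.zero_mem _
    · right
      rw [eq_top_iff]
      intro t _
      obtain ⟨m, rfl⟩ := hall t
      rw [← hι]
      exact (hN' m).mp (by rw [h]; trivial)

end Twist

end Final

theorem mainTheorem6 (k : Type*) [Field k] [IsAlgClosed k] (p : ℕ) [Fact p.Prime] [CharP k p]
    (n : ℕ) (hpn : p ∣ n) (l : Fin n → ZMod p) :
    IsSimpleModule (GLReduced p (regularNilpotent k n))
        (SimpleHead p (regularNilpotent k n) (regularNilpotent_borel k n) l) ∧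
      (Nonempty (TwistByTrace p (regularNilpotent k n)
            (SimpleHead p (regularNilpotent k n) (regularNilpotent_borel k n) l) 1
          ≃ₗ[GLReduced p (regularNilpotent k n)]
            SimpleHead p (regularNilpotent k n) (regularNilpotent_borel k n) l) ↔
        ∃ w : Equiv.Perm (Fin n), l = dotAction w 0) := by
  refine ⟨isSimpleModule_simpleHead l, ?_⟩
  set π := (sumOfProperSubmodules (GLReduced p (regularNilpotent k n))
    (BabyVerma p (regularNilpotent k n) (regularNilpotent_borel k n) l)).mkQ
  set v := π (babyVermaGen _ _ l) with hv
  have hs : IsSingular (modAct p (regularNilpotent k n)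
      (SimpleHead p (regularNilpotent k n) (regularNilpotent_borel k n) l)) l v :=
    (isSingular_babyVermaGen _ _ l).map π
  have hspan : Submodule.span (GLReduced p (regularNilpotent k n)) {v} = ⊤ := by
    rw [hv, ← Set.image_singleton, ← Submodule.map_span, span_babyVermaGen, Submodule.map_top,
      Submodule.range_mkQ]
  have hv0 : v ≠ 0 := by
    intro h
    rw [h, Submodule.span_zero_singleton] at hspan
    exact bot_ne_top hspan
  constructor
  · rintro ⟨ψ⟩
    refine exists_dotAction_zero_of_sumEntriesPow_eq hpn fun m => ?_
    -- The isomorphism carries v ⊗ 1, singular of weight l + 1, into the cyclic module generated by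
    -- v.
    exact hs.sumEntriesPow_eq (generates_of_span_eq_top hspan)
      ((hs.twistByTrace (a := 1)).map ψ.toLinearMap)
      (fun h => tmul_one_ne_zero hv0 (ψ.map_eq_zero_iff.mp h)) m
  · rintro ⟨w, hw⟩
    obtain ⟨τ, hτ⟩ := exists_weylRho_comp_eq hpn
    have hx : HasSingular (Algebra.lsmul k k
        (SimpleHead p (regularNilpotent k n) (regularNilpotent_borel k n) l) :
          GLReduced p (regularNilpotent k n) →ₐ[k] _) (l + weylRho) :=
      ⟨v, hv0, by rw [add_sub_cancel_right]; exact hs⟩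
    -- As l + ρ = ρ ∘ w⁻¹, this conjugate of τ lowers l + ρ by 1 everywhere; twisting by the trace
    -- then restores the weight l.
    obtain ⟨u, hu0, hu⟩ := hx.comp_perm (w * τ * w⁻¹)
    have hl : (l + weylRho) ∘ (w * τ * w⁻¹) - weylRho + (fun _ => 1) = l := by
      funext i
      have h1 := congrFun hτ (w⁻¹ i)
      simp only [Function.comp_apply, Pi.sub_apply, Pi.one_apply] at h1
      rw [hw]
      simp only [Pi.add_apply, Pi.sub_apply, Function.comp_apply, dotAction, Equiv.Perm.mul_apply,
        Pi.zero_apply]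
      have h2 : w⁻¹ (w (τ (w⁻¹ i))) = τ (w⁻¹ i) := w.symm_apply_apply _
      rw [h2, h1]
      ring
    have hu' := IsSingular.twistByTrace (a := 1) (p := p) (χ := regularNilpotent k n) hu
    rw [hl] at hu'
    obtain ⟨e⟩ := nonempty_simpleHead_equiv (M := TwistByTrace p (regularNilpotent k n)
      (SimpleHead p (regularNilpotent k n) (regularNilpotent_borel k n) l) 1)
      (tmul_one_ne_zero hu0) hu'
    exact ⟨e.symm⟩
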